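/- All manifolds are smooth, finite-dimensional, Hausdorff and without boundary. **Definitions.** A *smooth quasiloopoid* $G\rightrightarrows M$ is a manifold $G$ with a submanifold of units $M\subset G$, surjective submersions $\alpha,\beta:G\to M$ restricting to the identity on $M$, and a smooth product $(g,h)\mapsto gh\in G$ defined exactly on the closed submanifold $G^{(2)}=\{(g,h)\in G\times G:\beta(g)=\alpha(h)\}$, such that $g\,\beta(g)=g$, $\alpha(h)\,h=h$, and all translations $l_g:\alpha^{-1}(\beta(g))\to G$, $l_g(h)=gh$, and $r_h:\beta^{-1}(\alpha(h))\to G$, $r_h(g)=gh$, are injective immersions. A *morphism* from $B\rightrightarrows N$ to $G\rightrightarrows M$ is a smooth map $F:B\to G$ such that, whenever $xy$ is defined, $F(x)F(y)$ is defined and equals $F(xy)$. It then maps units to units and induces $\varphi:N\to M$. Let $AG=TG|_M/TM\to M$ be the normal bundle. For $X\in AG$ over $a\in M$, let $\bar X^\alpha,\bar X^\beta\in T_aG$ be the representatives of $X$ with $T\alpha(\bar X^\alpha)=0$, $T\beta(\bar X^\beta)=0$. A smooth section $X$ of $AG$ has the prolongations $\overleftarrow X(g)=T l_g\big(\bar X^\alpha(\beta(g))\big)$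 and $\overrightarrow X(g)=T r_g\big(\bar X^\beta(\alpha(g))\big)$. The left structure $A^lG$ has the bracket $[X,Y]_l(a)=[\overleftarrow X,\overleftarrow Y](a) \bmod T_aM$ and the anchor $\rho_l(X)=T\beta(\bar X^\alpha)$; the right structure $A^rG$ has the bracket $[X,Y]_r(a)=[\overrightarrow X,\overrightarrow Y](a)\bmod T_aM$ and the anchor $\rho_r(X)=T\alpha(\bar X^\beta)$. A *skew algebroid* is a vector bundle $E\to M$ with a skew-symmetric $\mathbb R$-bilinear bracket on its smooth sections and a vector bundle morphism $\rho:E\to TM$ with $[X,fY]=\rho(X)(f)\,Y+f[X,Y]$. A *skew subalgebroid* is a subbundle $E'\to M'$ over a submanifold $M'\subset M$ with $\rho(E')\subset TM'$ such that the sections of $E$ whose restriction to $M'$ takes values in $E'$ are closed under the bracket. A *skew algebroid morphism* $E_1\to E_2$ is a vector bundle morphism whose graph is a skew subalgebroid of the direct product $E_1\times E_2\to M_1\times M_2$ (the bracket of the product has $[X_1\boxplus X_2,Y_1\boxplus Y_2]=[X_1,Y_1]\boxplus[X_2,Y_2]$ and anchor $\rho_1\times\rho_2$). **Theorem.** Let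 $F$ be a morphism of smooth quasiloopoids from $B\rightrightarrows N$ to $G\rightrightarrows M$, with induced map $\varphi:N\to M$, and let $AF:AB\to AG$, $[v]\mapsto[TF(v)]$, be the induced map of normal bundles over $\varphi$. 1. $A^lB$, $A^rB$, $A^lG$, $A^rG$ are skew algebroids, with $\rho_r=-\rho_l$ on $AB$ and on $AG$. 2. $AF$ is a morphism of skew algebroids $A^lB\to A^lG$ and also a morphism of skew algebroids $A^rB\to A^rG$. 3. $A$ is functorial: $A(\mathrm{id}_B)=\mathrm{id}_{AB}$, and $A(F'\circ F)=AF'\circ AF$ for every further morphism $F'$ from $G\rightrightarrows M$ to a smooth quasiloopoid $K\rightrightarrows P$. -/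

import Mathlib

open scoped Manifold ContDiff Bundle Topology
open Set Bundle Manifold

set_option linter.unusedSectionVars false

noncomputable section

/-- A smooth quasiloopoid `G ⇉ M` (manifolds modelled on the spaces `EG`, `EM`).

* `target = α` and `source = β` are submersions `G → M`; `unit : M → G` embeds `M` as the
  submanifold of units. `α ∘ unit = β ∘ unit = id` says that the products in the unit laws are
  defined (and makes `α`, `β` surjective).
* The product of `g`, `h` is defined iff `β g = α h`; `mul` is a total function whose values on
  other pairs are irrelevant and never used. The set `G⁽²⁾` of composable pairs is a
  submanifold of `G × G` because `α`, `β` are submersions, and closed when `M` is Hausdorff;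
  on a submanifold, `ContMDiffOn` is the usual smoothness.
* The translations `l_g : α⁻¹(β g) → G` and `r_h : β⁻¹(α h) → G` are injective immersions.
  The tangent space of the `α`-fibre at `h` is `ker dα`; it lies in the tangent cone of the fibre,
  so `mfderivWithin` of `l_g` along the fibre is the tangent map `T l_g` on `ker dα`
  (and is only ever evaluated there). -/
structure SmoothQuasiloopoid (EG : Type*) [NormedAddCommGroup EG] [NormedSpace ℝ EG]
    (G : Type*) [TopologicalSpace G] [ChartedSpace EG G]
    (EM : Type*) [NormedAddCommGroup EM] [NormedSpace ℝ EM]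
    (M : Type*) [TopologicalSpace M] [ChartedSpace EM M] where
  /-- the target map `α` -/
  target : G → M
  /-- the source map `β` -/
  source : G → M
  /-- the embedding of the manifold of units -/
  unit : M → G
  /-- the product, meaningful for `source g = target h` only -/
  mul : G → G → G
  target_submersion : IsSubmersion 𝓘(ℝ, EG) 𝓘(ℝ, EM) ∞ target
  source_submersion : IsSubmersion 𝓘(ℝ, EG) 𝓘(ℝ, EM) ∞ source
  unit_embedding : IsSmoothEmbedding 𝓘(ℝ, EM) 𝓘(ℝ, EG) ∞ unit
  target_unit : ∀ a, target (unit a) = a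
  source_unit : ∀ a, source (unit a) = a
  contMDiffOn_mul : ContMDiffOn (𝓘(ℝ, EG).prod 𝓘(ℝ, EG)) 𝓘(ℝ, EG) ∞
    (fun p : G × G => mul p.1 p.2) {p | source p.1 = target p.2}
  mul_unit : ∀ g, mul g (unit (source g)) = g
  unit_mul : ∀ g, mul (unit (target g)) g = g
  left_injOn : ∀ g, InjOn (mul g) {h | target h = source g}
  right_injOn : ∀ h, InjOn (fun g => mul g h) {g | source g = target h}
  left_immersion : ∀ g h, target h = source g → ∀ v : TangentSpace 𝓘(ℝ, EG) h,
    mfderiv 𝓘(ℝ, EG) 𝓘(ℝ, EM) target h v = 0 →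
    mfderivWithin 𝓘(ℝ, EG) 𝓘(ℝ, EG) (mul g) {k | target k = source g} h v = 0 → v = 0
  right_immersion : ∀ g h, source g = target h → ∀ v : TangentSpace 𝓘(ℝ, EG) g,
    mfderiv 𝓘(ℝ, EG) 𝓘(ℝ, EM) source g v = 0 →
    mfderivWithin 𝓘(ℝ, EG) 𝓘(ℝ, EG) (fun k => mul k h) {k | source k = target h} g v = 0 → v = 0

/-- Model fibre of the normal bundle of `M` in `G`, of dimension `dim G - dim M`. -/
abbrev NormalModel (EG EM : Type*) [NormedAddCommGroup EG] [NormedSpace ℝ EG]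
    [NormedAddCommGroup EM] [NormedSpace ℝ EM] : Type :=
  EuclideanSpace ℝ (Fin (Module.finrank ℝ EG - Module.finrank ℝ EM))

namespace SmoothQuasiloopoid

variable {EG : Type*} [NormedAddCommGroup EG] [NormedSpace ℝ EG]
  {G : Type*} [TopologicalSpace G] [ChartedSpace EG G]
  {EM : Type*} [NormedAddCommGroup EM] [NormedSpace ℝ EM]
  {M : Type*} [TopologicalSpace M] [ChartedSpace EM M]

/-- `T_a M` as a subspace of `T_a G`. -/
def unitTangent (Q : SmoothQuasiloopoid EG G EM M) (a : M) :
    Submodule ℝ (TangentSpace 𝓘(ℝ, EG) (Q.unit a)) :=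
  LinearMap.range (mfderiv 𝓘(ℝ, EM) 𝓘(ℝ, EG) Q.unit a).toLinearMap

/-- The fibre `A_a G = T_a G / T_a M` of the normal bundle `AG`. -/
def NormalSpace (Q : SmoothQuasiloopoid EG G EM M) (a : M) : Type _ :=
  TangentSpace 𝓘(ℝ, EG) (Q.unit a) ⧸ Q.unitTangent a

variable (Q : SmoothQuasiloopoid EG G EM M)

instance (a : M) : AddCommGroup (Q.NormalSpace a) :=
  inferInstanceAs (AddCommGroup (TangentSpace 𝓘(ℝ, EG) (Q.unit a) ⧸ Q.unitTangent a))
instance (a : M) : Module ℝ (Q.NormalSpace a) :=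
  inferInstanceAs (Module ℝ (TangentSpace 𝓘(ℝ, EG) (Q.unit a) ⧸ Q.unitTangent a))
instance (a : M) : TopologicalSpace (Q.NormalSpace a) :=
  inferInstanceAs (TopologicalSpace (TangentSpace 𝓘(ℝ, EG) (Q.unit a) ⧸ Q.unitTangent a))

/-- The class of a tangent vector in the normal bundle. -/
def normalMk (a : M) : TangentSpace 𝓘(ℝ, EG) (Q.unit a) →L[ℝ] Q.NormalSpace a :=
  (Q.unitTangent a).mkQL

/-! ### The vector bundle structure of the normal bundle

Near `a₀`, take charts of `M` and `G` in which `M ⊂ G` is `u ↦ (u, 0)`. The second coordinate of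
the differential of the chart of `G` identifies `T_a G / T_a M` with the model fibre. -/

section NormalBundle

variable [FiniteDimensional ℝ EG] [FiniteDimensional ℝ EM]

theorem unit_immersionAt (a : M) :
    IsImmersionAtOfComplement (NormalModel EG EM) 𝓘(ℝ, EM) 𝓘(ℝ, EG) ∞ Q.unit a := by
  have h := Q.unit_embedding.isImmersion.isImmersionOfComplement_complement a
  have e := h.equiv
  have : FiniteDimensional ℝ Q.unit_embedding.isImmersion.complement := by
    have := LinearEquiv.finiteDimensional e.symm.toLinearEquiv
    exact FiniteDimensional.of_injective
      (LinearMap.inr ℝ EM Q.unit_embedding.isImmersion.complement) LinearMap.inr_injective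
  refine h.trans_F (ContinuousLinearEquiv.ofFinrankEq ?_)
  have := e.toLinearEquiv.finrank_eq
  rw [Module.finrank_prod] at this
  rw [finrank_euclideanSpace_fin]
  omega


/-- Slice chart of `G` near the unit `a₀`. -/
def codPart (a₀ : M) : OpenPartialHomeomorph G EG := (Q.unit_immersionAt a₀).codChart
/-- Chart of `M` near `a₀` belonging to the slice chart. -/
def domPart (a₀ : M) : OpenPartialHomeomorph M EM := (Q.unit_immersionAt a₀).domChart
/-- Splitting of the model space of `G` belonging to the slice chart. -/
def splitting (a₀ : M) : (EM × NormalModel EG EM) ≃L[ℝ] EG := (Q.unit_immersionAt a₀).equiv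

variable [IsManifold 𝓘(ℝ, EG) ∞ G] [IsManifold 𝓘(ℝ, EM) ∞ M]

theorem codPart_mdiff (a₀ : M) : (Q.codPart a₀).MDifferentiable 𝓘(ℝ, EG) 𝓘(ℝ, EG) :=
  ⟨(contMDiffOn_of_mem_maximalAtlas
      (Q.unit_immersionAt a₀).codChart_mem_maximalAtlas).mdifferentiableOn (by simp),
    (contMDiffOn_symm_of_mem_maximalAtlas
      (Q.unit_immersionAt a₀).codChart_mem_maximalAtlas).mdifferentiableOn (by simp)⟩

theorem domPart_mdiff (a₀ : M) : (Q.domPart a₀).MDifferentiable 𝓘(ℝ, EM) 𝓘(ℝ, EM) :=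
  ⟨(contMDiffOn_of_mem_maximalAtlas
      (Q.unit_immersionAt a₀).domChart_mem_maximalAtlas).mdifferentiableOn (by simp),
    (contMDiffOn_symm_of_mem_maximalAtlas
      (Q.unit_immersionAt a₀).domChart_mem_maximalAtlas).mdifferentiableOn (by simp)⟩

theorem unit_mem_codPart {a₀ a : M} (ha : a ∈ (Q.domPart a₀).source) :
    Q.unit a ∈ (Q.codPart a₀).source :=
  (Q.unit_immersionAt a₀).source_subset_preimage_source ha

theorem codPart_unit {a₀ a : M} (ha : a ∈ (Q.domPart a₀).source) :
    Q.codPart a₀ (Q.unit a) = Q.splitting a₀ (Q.domPart a₀ a, 0) := by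
  have hx : Q.domPart a₀ a ∈ ((Q.unit_immersionAt a₀).domChart.extend 𝓘(ℝ, EM)).target := by
    simpa [domPart] using (Q.domPart a₀).map_source ha
  have h := (Q.unit_immersionAt a₀).writtenInCharts hx
  simpa [domPart, codPart, splitting, (Q.domPart a₀).left_inv ha,
    show (Q.unit_immersionAt a₀).domChart.symm ((Q.unit_immersionAt a₀).domChart a) = a from
      (Q.domPart a₀).left_inv ha] using h

/-- The normal coordinate, in the slice chart near `a₀`, of a tangent vector at `a`. -/
def normalCoord (a₀ a : M) : TangentSpace 𝓘(ℝ, EG) (Q.unit a) →L[ℝ] NormalModel EG EM :=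
  (ContinuousLinearMap.snd ℝ EM (NormalModel EG EM)).comp
    (((Q.splitting a₀).symm : EG →L[ℝ] EM × NormalModel EG EM).comp
      (mfderiv 𝓘(ℝ, EG) 𝓘(ℝ, EG) (Q.codPart a₀) (Q.unit a)))

/-- The tangent vector at `a` with given normal coordinate and tangential coordinate `0`. -/
def normalLift (a₀ a : M) : NormalModel EG EM →L[ℝ] TangentSpace 𝓘(ℝ, EG) (Q.unit a) :=
  (mfderiv 𝓘(ℝ, EG) 𝓘(ℝ, EG) (Q.codPart a₀).symm (Q.codPart a₀ (Q.unit a))).comp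
    ((Q.splitting a₀ : EM × NormalModel EG EM →L[ℝ] EG).comp
      (ContinuousLinearMap.inr ℝ EM (NormalModel EG EM)))

theorem mfderiv_codPart_unit {a₀ a : M} (ha : a ∈ (Q.domPart a₀).source)
    (u : TangentSpace 𝓘(ℝ, EM) a) :
    mfderiv 𝓘(ℝ, EG) 𝓘(ℝ, EG) (Q.codPart a₀) (Q.unit a)
      (mfderiv 𝓘(ℝ, EM) 𝓘(ℝ, EG) Q.unit a u) =
    Q.splitting a₀ (mfderiv 𝓘(ℝ, EM) 𝓘(ℝ, EM) (Q.domPart a₀) a u, 0) := by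
  have hε : MDifferentiableAt 𝓘(ℝ, EM) 𝓘(ℝ, EG) Q.unit a :=
    (Q.unit_embedding.contMDiff a).mdifferentiableAt (by simp)
  have hψ := (Q.codPart_mdiff a₀).mdifferentiableAt (Q.unit_mem_codPart ha)
  have hφ := (Q.domPart_mdiff a₀).mdifferentiableAt ha
  have h1 : HasMFDerivAt 𝓘(ℝ, EM) 𝓘(ℝ, EG) (Q.codPart a₀ ∘ Q.unit) a
      ((mfderiv 𝓘(ℝ, EG) 𝓘(ℝ, EG) (Q.codPart a₀) (Q.unit a)).comp
        (mfderiv 𝓘(ℝ, EM) 𝓘(ℝ, EG) Q.unit a)) :=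
    hψ.hasMFDerivAt.comp a hε.hasMFDerivAt
  let L : EM →L[ℝ] EG := (Q.splitting a₀ : EM × NormalModel EG EM →L[ℝ] EG).comp
      (ContinuousLinearMap.inl ℝ EM (NormalModel EG EM))
  have h2 : HasMFDerivAt 𝓘(ℝ, EM) 𝓘(ℝ, EG) (L ∘ Q.domPart a₀) a
      (L.comp (mfderiv 𝓘(ℝ, EM) 𝓘(ℝ, EM) (Q.domPart a₀) a)) :=
    HasMFDerivAt.comp a (L.hasMFDerivAt) hφ.hasMFDerivAt
  have h3 := h2.congr_of_eventuallyEq (f₁ := Q.codPart a₀ ∘ Q.unit) (by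
    filter_upwards [(Q.domPart a₀).open_source.mem_nhds ha] with b hb
    simpa [L] using Q.codPart_unit hb)
  exact DFunLike.congr_fun (hasMFDerivAt_unique h1 h3) u

theorem normalCoord_ker {a₀ a : M} (ha : a ∈ (Q.domPart a₀).source) :
    Q.unitTangent a ≤ LinearMap.ker (Q.normalCoord a₀ a).toLinearMap := by
  rintro _ ⟨u, rfl⟩
  have := Q.mfderiv_codPart_unit ha u
  simp only [LinearMap.mem_ker]
  change ((Q.splitting a₀).symm (mfderiv 𝓘(ℝ, EG) 𝓘(ℝ, EG) (Q.codPart a₀) (Q.unit a)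
      (mfderiv 𝓘(ℝ, EM) 𝓘(ℝ, EG) Q.unit a u))).2 = 0
  rw [this]
  simp

theorem normalCoord_normalLift {a₀ a : M} (ha : a ∈ (Q.domPart a₀).source)
    (w : NormalModel EG EM) : Q.normalCoord a₀ a (Q.normalLift a₀ a w) = w := by
  have h := DFunLike.congr_fun ((Q.codPart_mdiff a₀).comp_symm_deriv
    ((Q.codPart a₀).map_source (Q.unit_mem_codPart ha))) (Q.splitting a₀ (0, w))
  rw [(Q.codPart a₀).left_inv (Q.unit_mem_codPart ha)] at h
  change ((Q.splitting a₀).symm (mfderiv 𝓘(ℝ, EG) 𝓘(ℝ, EG) (Q.codPart a₀) (Q.unit a)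
    (mfderiv 𝓘(ℝ, EG) 𝓘(ℝ, EG) (Q.codPart a₀).symm (Q.codPart a₀ (Q.unit a))
      (Q.splitting a₀ (0, w))))).2 = w
  change mfderiv 𝓘(ℝ, EG) 𝓘(ℝ, EG) (Q.codPart a₀) (Q.unit a)
    (mfderiv 𝓘(ℝ, EG) 𝓘(ℝ, EG) (Q.codPart a₀).symm (Q.codPart a₀ (Q.unit a))
      (Q.splitting a₀ (0, w))) = Q.splitting a₀ (0, w) at h
  rw [h]
  simp

theorem normalCoord_eq_zero {a₀ a : M} (ha : a ∈ (Q.domPart a₀).source)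
    {v : TangentSpace 𝓘(ℝ, EG) (Q.unit a)} (hv : Q.normalCoord a₀ a v = 0) :
    v ∈ Q.unitTangent a := by
  set u : EM := ((Q.splitting a₀).symm (mfderiv 𝓘(ℝ, EG) 𝓘(ℝ, EG) (Q.codPart a₀) (Q.unit a) v)).1
    with hu
  have h1 : mfderiv 𝓘(ℝ, EG) 𝓘(ℝ, EG) (Q.codPart a₀) (Q.unit a) v = Q.splitting a₀ (u, 0) := by
    exact (Q.splitting a₀).symm_apply_eq.1 (Prod.ext rfl hv)
  have h2 := DFunLike.congr_fun ((Q.domPart_mdiff a₀).comp_symm_deriv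
    ((Q.domPart a₀).map_source ha)) u
  rw [(Q.domPart a₀).left_inv ha] at h2
  refine ⟨mfderiv 𝓘(ℝ, EM) 𝓘(ℝ, EM) (Q.domPart a₀).symm (Q.domPart a₀ a) u, ?_⟩
  have h3 := (Q.codPart_mdiff a₀).symm_comp_deriv (Q.unit_mem_codPart ha)
  have hinj : Function.Injective (mfderiv 𝓘(ℝ, EG) 𝓘(ℝ, EG) (Q.codPart a₀) (Q.unit a)) := by
    intro x y hxy
    have hx := DFunLike.congr_fun h3 x
    have hy := DFunLike.congr_fun h3 y
    change mfderiv 𝓘(ℝ, EG) 𝓘(ℝ, EG) (Q.codPart a₀).symm _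
      (mfderiv 𝓘(ℝ, EG) 𝓘(ℝ, EG) (Q.codPart a₀) (Q.unit a) x) = x at hx
    change mfderiv 𝓘(ℝ, EG) 𝓘(ℝ, EG) (Q.codPart a₀).symm _
      (mfderiv 𝓘(ℝ, EG) 𝓘(ℝ, EG) (Q.codPart a₀) (Q.unit a) y) = y at hy
    rw [← hx, ← hy, hxy]
  apply hinj
  refine (Q.mfderiv_codPart_unit ha _).trans ?_
  rw [h1]
  exact congrArg (fun z => Q.splitting a₀ (z, 0)) h2

/-- Local trivialisation of the normal bundle, fibrewise. -/
def normalEquiv (a₀ a : M) (ha : a ∈ (Q.domPart a₀).source) :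
    Q.NormalSpace a ≃L[ℝ] NormalModel EG EM :=
  ContinuousLinearEquiv.equivOfInverse
    ((Q.unitTangent a).liftQL (Q.normalCoord a₀ a) (Q.normalCoord_ker ha))
    ((Q.normalMk a).comp (Q.normalLift a₀ a))
    (by
      intro x
      obtain ⟨v, rfl⟩ := Submodule.Quotient.mk_surjective _ x
      refine (Submodule.Quotient.eq _).2 (Q.normalCoord_eq_zero ha ?_)
      rw [map_sub]
      exact sub_eq_zero.2 (Q.normalCoord_normalLift ha _))
    (fun w => Q.normalCoord_normalLift ha w)

open Classical in
/-- Local trivialisation of the normal bundle near `a₀`. -/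
def normalPretrivialization (a₀ : M) :
    Pretrivialization (NormalModel EG EM) (π (NormalModel EG EM) Q.NormalSpace) where
  toFun p := (p.1, if h : p.1 ∈ (Q.domPart a₀).source then Q.normalEquiv a₀ p.1 h p.2 else 0)
  invFun p := ⟨p.1, Q.normalMk p.1 (Q.normalLift a₀ p.1 p.2)⟩
  source := π (NormalModel EG EM) Q.NormalSpace ⁻¹' (Q.domPart a₀).source
  target := (Q.domPart a₀).source ×ˢ univ
  map_source' p hp := ⟨hp, mem_univ _⟩
  map_target' p hp := hp.1
  left_inv' := by
    rintro ⟨a, x⟩ ha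
    replace ha : a ∈ (Q.domPart a₀).source := ha
    simp only [dif_pos ha]
    congr 1
    exact (Q.normalEquiv a₀ a ha).symm_apply_apply x
  right_inv' := by
    rintro ⟨a, w⟩ ⟨ha, -⟩
    simp only at ha
    simp only [dif_pos ha]
    congr 1
    exact (Q.normalEquiv a₀ a ha).apply_symm_apply w
  open_target := (Q.domPart a₀).open_source.prod isOpen_univ
  baseSet := (Q.domPart a₀).source
  open_baseSet := (Q.domPart a₀).open_source
  source_eq := rfl
  target_eq := rfl
  proj_toFun _ _ := rfl

theorem normalPretrivialization_apply {a₀ a : M} (ha : a ∈ (Q.domPart a₀).source)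
    (x : Q.NormalSpace a) :
    Q.normalPretrivialization a₀ ⟨a, x⟩ = (a, Q.normalEquiv a₀ a ha x) := by
  exact Prod.ext rfl (dif_pos ha)

theorem normalPretrivialization_symm {a₀ a : M} (ha : a ∈ (Q.domPart a₀).source)
    (w : NormalModel EG EM) :
    (Q.normalPretrivialization a₀).symm a w = Q.normalMk a (Q.normalLift a₀ a w) := by
  rw [Pretrivialization.symm_apply _ ha]
  rfl

theorem contMDiffOn_normalChange (a₀ a₁ : M) :
    ContMDiffOn 𝓘(ℝ, EM) 𝓘(ℝ, NormalModel EG EM →L[ℝ] NormalModel EG EM) ∞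
      (fun a => ((Q.normalCoord a₁ a).comp (Q.normalLift a₀ a) :
        NormalModel EG EM →L[ℝ] NormalModel EG EM))
      ((Q.domPart a₀).source ∩ (Q.domPart a₁).source) := by
  set T := (Q.codPart a₀).symm.trans (Q.codPart a₁) with hT
  have hTs : ContDiffOn ℝ ∞ T T.source := by
    have h0 := contMDiffOn_symm_of_mem_maximalAtlas
      (Q.unit_immersionAt a₀).codChart_mem_maximalAtlas
    have h1 := contMDiffOn_of_mem_maximalAtlas
      (Q.unit_immersionAt a₁).codChart_mem_maximalAtlas
    rw [← contMDiffOn_iff_contDiffOn]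
    refine (h1.comp' h0).mono ?_
    intro x hx
    simpa [hT, codPart] using hx
  have hdT : ContDiffOn ℝ ∞ (fderiv ℝ T) T.source :=
    hTs.fderiv_of_isOpen T.open_source (by simp)
  have hmem : MapsTo (fun a => Q.codPart a₀ (Q.unit a))
      ((Q.domPart a₀).source ∩ (Q.domPart a₁).source) T.source := by
    rintro a ⟨h0, h1⟩
    rw [hT, OpenPartialHomeomorph.trans_source]
    refine ⟨(Q.codPart a₀).map_source (Q.unit_mem_codPart h0), ?_⟩
    rw [mem_preimage, (Q.codPart a₀).left_inv (Q.unit_mem_codPart h0)]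
    exact Q.unit_mem_codPart h1
  have hψε : ContMDiffOn 𝓘(ℝ, EM) 𝓘(ℝ, EG) ∞ (fun a => Q.codPart a₀ (Q.unit a))
      ((Q.domPart a₀).source ∩ (Q.domPart a₁).source) :=
    (contMDiffOn_of_mem_maximalAtlas
      (Q.unit_immersionAt a₀).codChart_mem_maximalAtlas).comp
      Q.unit_embedding.contMDiff.contMDiffOn fun a ha => Q.unit_mem_codPart ha.1
  have hd : ContMDiffOn 𝓘(ℝ, EM) 𝓘(ℝ, EG →L[ℝ] EG) ∞
      (fun a => fderiv ℝ T (Q.codPart a₀ (Q.unit a)))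
      ((Q.domPart a₀).source ∩ (Q.domPart a₁).source) :=
    (contMDiffOn_iff_contDiffOn.2 hdT).comp hψε hmem
  let P : EG →L[ℝ] NormalModel EG EM := (ContinuousLinearMap.snd ℝ EM (NormalModel EG EM)).comp
    ((Q.splitting a₁).symm : EG →L[ℝ] EM × NormalModel EG EM)
  let J : NormalModel EG EM →L[ℝ] EG := (Q.splitting a₀ : EM × NormalModel EG EM →L[ℝ] EG).comp
      (ContinuousLinearMap.inr ℝ EM (NormalModel EG EM))
  have hfin : ContMDiffOn 𝓘(ℝ, EM) 𝓘(ℝ, NormalModel EG EM →L[ℝ] NormalModel EG EM) ∞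
      (fun a => P.comp ((fderiv ℝ T (Q.codPart a₀ (Q.unit a))).comp J))
      ((Q.domPart a₀).source ∩ (Q.domPart a₁).source) :=
    (contMDiffOn_const (c := P)).clm_comp (hd.clm_comp (contMDiffOn_const (c := J)))
  refine hfin.congr ?_
  rintro a ⟨h0, h1⟩
  have hs := (Q.codPart_mdiff a₀).mdifferentiableAt_symm
    ((Q.codPart a₀).map_source (Q.unit_mem_codPart h0))
  have hc := (Q.codPart_mdiff a₁).mdifferentiableAt (Q.unit_mem_codPart h1)
  have hcomp : mfderiv 𝓘(ℝ, EG) 𝓘(ℝ, EG) T (Q.codPart a₀ (Q.unit a)) =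
      (mfderiv 𝓘(ℝ, EG) 𝓘(ℝ, EG) (Q.codPart a₁) (Q.unit a)).comp
        (mfderiv 𝓘(ℝ, EG) 𝓘(ℝ, EG) (Q.codPart a₀).symm (Q.codPart a₀ (Q.unit a))) := by
    have hc' : ∀ z (hz : z = Q.unit a), HasMFDerivAt 𝓘(ℝ, EG) 𝓘(ℝ, EG) (Q.codPart a₁) z
        (mfderiv 𝓘(ℝ, EG) 𝓘(ℝ, EG) (Q.codPart a₁) (Q.unit a)) := by
      rintro _ rfl
      exact hc.hasMFDerivAt
    exact ((hc' _ ((Q.codPart a₀).left_inv (Q.unit_mem_codPart h0))).comp _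
      hs.hasMFDerivAt).mfderiv
  rw [mfderiv_eq_fderiv] at hcomp
  rw [hcomp]
  rfl

theorem normalChange_apply (a₀ a₁ : M) {a : M}
    (ha : a ∈ (Q.domPart a₀).source ∩ (Q.domPart a₁).source) (w : NormalModel EG EM) :
    Q.normalCoord a₁ a (Q.normalLift a₀ a w) =
      (Q.normalPretrivialization a₁ ⟨a, (Q.normalPretrivialization a₀).symm a w⟩).2 := by
  rw [Q.normalPretrivialization_apply ha.2, Q.normalPretrivialization_symm ha.1]
  rfl

/-- The smooth vector bundle structure of the normal bundle `AG → M`. -/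
def normalPrebundle : VectorPrebundle ℝ (NormalModel EG EM) Q.NormalSpace where
  pretrivializationAtlas := range Q.normalPretrivialization
  pretrivialization_linear' := by
    rintro _ ⟨a₀, rfl⟩
    refine ⟨fun a ha => ?_⟩
    have : (fun x : Q.NormalSpace a => (Q.normalPretrivialization a₀ ⟨a, x⟩).2) =
        Q.normalEquiv a₀ a ha := by
      ext1 x
      rw [Q.normalPretrivialization_apply ha]
    rw [this]
    exact (Q.normalEquiv a₀ a ha).toLinearEquiv.toLinearMap.isLinear
  pretrivializationAt := Q.normalPretrivialization
  mem_base_pretrivializationAt a := (Q.unit_immersionAt a).mem_domChart_source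
  pretrivialization_mem_atlas a := mem_range_self a
  exists_coordChange := by
    rintro _ ⟨a₀, rfl⟩ _ ⟨a₁, rfl⟩
    exact ⟨_, (Q.contMDiffOn_normalChange a₀ a₁).continuousOn,
      fun a ha w => Q.normalChange_apply a₀ a₁ ha w⟩
  totalSpaceMk_isInducing a := by
    have ha : a ∈ (Q.domPart a).source := (Q.unit_immersionAt a).mem_domChart_source
    have : Q.normalPretrivialization a ∘ TotalSpace.mk a =
        fun x => (a, Q.normalEquiv a a ha x) := by
      ext1 x
      exact Q.normalPretrivialization_apply ha x
    rw [this]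
    exact Topology.isInducing_const_prod.2 (Q.normalEquiv a a ha).toHomeomorph.isInducing

instance : TopologicalSpace (TotalSpace (NormalModel EG EM) Q.NormalSpace) :=
  Q.normalPrebundle.totalSpaceTopology
instance : FiberBundle (NormalModel EG EM) Q.NormalSpace := Q.normalPrebundle.toFiberBundle
instance : VectorBundle ℝ (NormalModel EG EM) Q.NormalSpace := Q.normalPrebundle.toVectorBundle

instance : Q.normalPrebundle.IsContMDiff 𝓘(ℝ, EM) ∞ where
  exists_contMDiffCoordChange := by
    rintro _ ⟨a₀, rfl⟩ _ ⟨a₁, rfl⟩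
    exact ⟨_, Q.contMDiffOn_normalChange a₀ a₁, fun a ha w => Q.normalChange_apply a₀ a₁ ha w⟩

instance : ContMDiffVectorBundle ∞ (NormalModel EG EM) Q.NormalSpace 𝓘(ℝ, EM) :=
  Q.normalPrebundle.contMDiffVectorBundle 𝓘(ℝ, EM)


end NormalBundle

/-! ### Left and right prolongations -/

theorem mfderiv_target_unit (a : M) (u : TangentSpace 𝓘(ℝ, EM) a) :
    mfderiv 𝓘(ℝ, EG) 𝓘(ℝ, EM) Q.target (Q.unit a) (mfderiv 𝓘(ℝ, EM) 𝓘(ℝ, EG) Q.unit a u) = u := by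
  have h1 : HasMFDerivAt 𝓘(ℝ, EM) 𝓘(ℝ, EM) (Q.target ∘ Q.unit) a _ :=
    (((Q.target_submersion.contMDiff _).mdifferentiableAt (by simp)).hasMFDerivAt).comp a
      (((Q.unit_embedding.contMDiff a).mdifferentiableAt (by simp)).hasMFDerivAt)
  have h2 : Q.target ∘ Q.unit = id := funext Q.target_unit
  rw [h2] at h1
  exact DFunLike.congr_fun (hasMFDerivAt_unique h1 (hasMFDerivAt_id a)) u

theorem mfderiv_source_unit (a : M) (u : TangentSpace 𝓘(ℝ, EM) a) :
    mfderiv 𝓘(ℝ, EG) 𝓘(ℝ, EM) Q.source (Q.unit a) (mfderiv 𝓘(ℝ, EM) 𝓘(ℝ, EG) Q.unit a u) = u := by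
  have h1 : HasMFDerivAt 𝓘(ℝ, EM) 𝓘(ℝ, EM) (Q.source ∘ Q.unit) a _ :=
    (((Q.source_submersion.contMDiff _).mdifferentiableAt (by simp)).hasMFDerivAt).comp a
      (((Q.unit_embedding.contMDiff a).mdifferentiableAt (by simp)).hasMFDerivAt)
  have h2 : Q.source ∘ Q.unit = id := funext Q.source_unit
  rw [h2] at h1
  exact DFunLike.congr_fun (hasMFDerivAt_unique h1 (hasMFDerivAt_id a)) u

/-- `X ↦ X̄^α`: the representative of a normal vector tangent to the `α`-fibre,
`[v] ↦ v - d(unit) (dα v)`. -/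
def leftRep (a : M) : Q.NormalSpace a →ₗ[ℝ] TangentSpace 𝓘(ℝ, EG) (Q.unit a) :=
  (Q.unitTangent a).liftQ
    (LinearMap.id - (mfderiv 𝓘(ℝ, EM) 𝓘(ℝ, EG) Q.unit a).toLinearMap ∘ₗ
      (mfderiv 𝓘(ℝ, EG) 𝓘(ℝ, EM) Q.target (Q.unit a)).toLinearMap) (by
    rintro _ ⟨u, rfl⟩
    have := Q.mfderiv_target_unit a u
    exact sub_eq_zero.2 (congrArg (mfderiv 𝓘(ℝ, EM) 𝓘(ℝ, EG) Q.unit a) this.symm))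

/-- `X ↦ X̄^β`: the representative of a normal vector tangent to the `β`-fibre,
`[v] ↦ v - d(unit) (dβ v)`. -/
def rightRep (a : M) : Q.NormalSpace a →ₗ[ℝ] TangentSpace 𝓘(ℝ, EG) (Q.unit a) :=
  (Q.unitTangent a).liftQ
    (LinearMap.id - (mfderiv 𝓘(ℝ, EM) 𝓘(ℝ, EG) Q.unit a).toLinearMap ∘ₗ
      (mfderiv 𝓘(ℝ, EG) 𝓘(ℝ, EM) Q.source (Q.unit a)).toLinearMap) (by
    rintro _ ⟨u, rfl⟩
    have := Q.mfderiv_source_unit a u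
    exact sub_eq_zero.2 (congrArg (mfderiv 𝓘(ℝ, EM) 𝓘(ℝ, EG) Q.unit a) this.symm))

theorem normalMk_leftRep (a : M) (X : Q.NormalSpace a) : Q.normalMk a (Q.leftRep a X) = X := by
  obtain ⟨v, rfl⟩ := Submodule.Quotient.mk_surjective _ X
  refine (Submodule.Quotient.eq _).2 ⟨-(mfderiv 𝓘(ℝ, EG) 𝓘(ℝ, EM) Q.target (Q.unit a) v), ?_⟩
  refine (map_neg (mfderiv 𝓘(ℝ, EM) 𝓘(ℝ, EG) Q.unit a) _).trans ?_
  exact (sub_sub_cancel_left v _).symm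

theorem mfderiv_target_leftRep (a : M) (X : Q.NormalSpace a) :
    mfderiv 𝓘(ℝ, EG) 𝓘(ℝ, EM) Q.target (Q.unit a) (Q.leftRep a X) = 0 := by
  obtain ⟨v, rfl⟩ := Submodule.Quotient.mk_surjective _ X
  refine (map_sub (mfderiv 𝓘(ℝ, EG) 𝓘(ℝ, EM) Q.target (Q.unit a)) v _).trans ?_
  exact sub_eq_zero.2 (Q.mfderiv_target_unit a _).symm

theorem normalMk_rightRep (a : M) (X : Q.NormalSpace a) : Q.normalMk a (Q.rightRep a X) = X := by
  obtain ⟨v, rfl⟩ := Submodule.Quotient.mk_surjective _ X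
  refine (Submodule.Quotient.eq _).2 ⟨-(mfderiv 𝓘(ℝ, EG) 𝓘(ℝ, EM) Q.source (Q.unit a) v), ?_⟩
  refine (map_neg (mfderiv 𝓘(ℝ, EM) 𝓘(ℝ, EG) Q.unit a) _).trans ?_
  exact (sub_sub_cancel_left v _).symm

theorem mfderiv_source_rightRep (a : M) (X : Q.NormalSpace a) :
    mfderiv 𝓘(ℝ, EG) 𝓘(ℝ, EM) Q.source (Q.unit a) (Q.rightRep a X) = 0 := by
  obtain ⟨v, rfl⟩ := Submodule.Quotient.mk_surjective _ X
  refine (map_sub (mfderiv 𝓘(ℝ, EG) 𝓘(ℝ, EM) Q.source (Q.unit a)) v _).trans ?_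
  exact sub_eq_zero.2 (Q.mfderiv_source_unit a _).symm

/-- The left prolongation `g ↦ T l_g (X̄^α (β g))` of a section `X` of `AG`. The base point
`g · unit (β g)` is `g`. -/
def leftProlongation (X : ∀ a, Q.NormalSpace a) (g : G) : TangentSpace 𝓘(ℝ, EG) g :=
  mfderivWithin 𝓘(ℝ, EG) 𝓘(ℝ, EG) (Q.mul g) {h | Q.target h = Q.source g}
    (Q.unit (Q.source g)) (Q.leftRep (Q.source g) (X (Q.source g)))

/-- The right prolongation `h ↦ T r_h (X̄^β (α h))` of a section `X` of `AG`. The base point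
`unit (α h) · h` is `h`. -/
def rightProlongation (X : ∀ a, Q.NormalSpace a) (h : G) : TangentSpace 𝓘(ℝ, EG) h :=
  mfderivWithin 𝓘(ℝ, EG) 𝓘(ℝ, EG) (fun g => Q.mul g h) {g | Q.source g = Q.target h}
    (Q.unit (Q.target h)) (Q.rightRep (Q.target h) (X (Q.target h)))

end SmoothQuasiloopoid

/-! ### Skew algebroids -/

section Algebroid

variable {EM : Type*} [NormedAddCommGroup EM] [NormedSpace ℝ EM]
  {HM : Type*} [TopologicalSpace HM] (I : ModelWithCorners ℝ EM HM)
  {M : Type*} [TopologicalSpace M] [ChartedSpace HM M]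

/-- A bracket on sections and an anchor for a vector bundle `E → M`. The bracket is a function on
all sections; only its values on smooth sections matter. The laws are in `IsSkewAlgebroid`. -/
structure AlgebroidData (E : M → Type*) [∀ x, AddCommMonoid (E x)] [∀ x, Module ℝ (E x)] where
  /-- the bracket of sections -/
  bracket : (∀ x, E x) → (∀ x, E x) → ∀ x, E x
  /-- the anchor, a linear map on each fibre -/
  anchor : ∀ x, E x →ₗ[ℝ] TangentSpace I x

variable (F : Type*) [NormedAddCommGroup F] [NormedSpace ℝ F] {E : M → Type*}
  [TopologicalSpace (TotalSpace F E)] [∀ x, TopologicalSpace (E x)] [∀ x, AddCommMonoid (E x)]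
  [∀ x, Module ℝ (E x)] [FiberBundle F E]

/-- `X` is a smooth section of `E → M`. -/
def IsSmoothSection (X : ∀ x, E x) : Prop :=
  ContMDiff I (I.prod 𝓘(ℝ, F)) ∞ fun x => (⟨x, X x⟩ : TotalSpace F E)

variable {I}

variable (I) in
/-- The derivative of a function in the direction of a tangent vector. -/
def directionalDeriv (f : M → ℝ) (x : M) (w : TangentSpace I x) : ℝ := mfderiv I 𝓘(ℝ, ℝ) f x w

/-- Skew algebroid on a vector bundle `E → M`: a skew-symmetric `ℝ`-bilinear bracket on smooth
sections and a vector bundle morphism `ρ : E → TM` with `[X, fY] = ρ(X)(f) Y + f [X, Y]`.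
(Linearity in the first argument follows from skewness.) -/
structure IsSkewAlgebroid [IsManifold I ∞ M] (A : AlgebroidData I E) : Prop where
  contMDiff_anchor : ContMDiff (I.prod 𝓘(ℝ, F)) (I.prod 𝓘(ℝ, EM)) ∞
    fun e : TotalSpace F E => (⟨e.1, A.anchor e.1 e.2⟩ : TangentBundle I M)
  smooth_bracket : ∀ X Y : ∀ x, E x, IsSmoothSection I F X → IsSmoothSection I F Y →
    IsSmoothSection I F (A.bracket X Y)
  skew : ∀ X Y : ∀ x, E x, IsSmoothSection I F X → IsSmoothSection I F Y → ∀ x,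
    A.bracket X Y x + A.bracket Y X x = 0
  bracket_add : ∀ X Y Z : ∀ x, E x, IsSmoothSection I F X → IsSmoothSection I F Y →
    IsSmoothSection I F Z → ∀ x,
    A.bracket X (fun y => Y y + Z y) x = A.bracket X Y x + A.bracket X Z x
  bracket_smul : ∀ X Y : ∀ x, E x, IsSmoothSection I F X → IsSmoothSection I F Y →
    ∀ (c : ℝ) (x : M), A.bracket X (fun y => c • Y y) x = c • A.bracket X Y x
  leibniz : ∀ X Y : ∀ x, E x, IsSmoothSection I F X → IsSmoothSection I F Y →
    ∀ f : M → ℝ, ContMDiff I 𝓘(ℝ, ℝ) ∞ f → ∀ x : M,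
    A.bracket X (fun y => f y • Y y) x =
      directionalDeriv I f x (A.anchor x (X x)) • Y x + f x • A.bracket X Y x

/-- Skew subalgebroid of `E → M`: a submanifold (the image of the embedding `j : N → M`), with a
subbundle `B` of `E` over it (locally spanned by a smooth frame), such that `ρ(B) ⊂ TN` and the
smooth sections of `E` whose restriction to `N` takes values in `B` are closed under the
bracket. -/
structure IsSkewSubalgebroid {EN : Type*} [NormedAddCommGroup EN] [NormedSpace ℝ EN]
    {HN : Type*} [TopologicalSpace HN] (J : ModelWithCorners ℝ EN HN)
    {N : Type*} [TopologicalSpace N] [ChartedSpace HN N]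
    (A : AlgebroidData I E) (j : N → M) (B : ∀ n, Submodule ℝ (E (j n))) : Prop where
  isSmoothEmbedding : IsSmoothEmbedding J I ∞ j
  exists_frame : ∀ n₀ : N, ∃ U : Set N, IsOpen U ∧ n₀ ∈ U ∧
    ∃ (k : ℕ) (s : Fin k → ∀ n, E (j n)),
      (∀ i, ContMDiffOn J (I.prod 𝓘(ℝ, F)) ∞ (fun n => (⟨j n, s i n⟩ : TotalSpace F E)) U) ∧
      ∀ n ∈ U, LinearIndependent ℝ (fun i => s i n) ∧
        Submodule.span ℝ (range fun i => s i n) = B n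
  anchor_mem : ∀ n, ∀ e ∈ B n, A.anchor (j n) e ∈ range (mfderiv J I j n)
  bracket_mem : ∀ X Y : ∀ x, E x, IsSmoothSection I F X → IsSmoothSection I F Y →
    (∀ n, X (j n) ∈ B n) → (∀ n, Y (j n) ∈ B n) → ∀ n, A.bracket X Y (j n) ∈ B n

variable [VectorBundle ℝ F E] (E)

/-- Derivative, in the direction `w`, of a map `s : N → E_x` into one fibre, which is a vector
space. A linear identification of `E_x` with the model fibre is used; the result does not
depend on it. -/
def fibreDeriv {EN : Type*} [NormedAddCommGroup EN] [NormedSpace ℝ EN]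
    {HN : Type*} [TopologicalSpace HN] (J : ModelWithCorners ℝ EN HN)
    {N : Type*} [TopologicalSpace N] [ChartedSpace HN N]
    (x : M) (s : N → E x) (n : N) (w : TangentSpace J n) : E x :=
  ((trivializationAt F E x).continuousLinearEquivAt ℝ x
    (FiberBundle.mem_baseSet_trivializationAt' x)).symm
    (mfderiv J 𝓘(ℝ, F) (fun m => (trivializationAt F E x).continuousLinearEquivAt ℝ x
      (FiberBundle.mem_baseSet_trivializationAt' x) (s m)) n w)

end Algebroid

section Product

variable {E₁ : Type*} [NormedAddCommGroup E₁] [NormedSpace ℝ E₁]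
  {H₁ : Type*} [TopologicalSpace H₁] (I₁ : ModelWithCorners ℝ E₁ H₁)
  {M₁ : Type*} [TopologicalSpace M₁] [ChartedSpace H₁ M₁]
  (F₁ : Type*) [NormedAddCommGroup F₁] [NormedSpace ℝ F₁] (V₁ : M₁ → Type*)
  [TopologicalSpace (TotalSpace F₁ V₁)] [∀ x, TopologicalSpace (V₁ x)] [∀ x, AddCommGroup (V₁ x)]
  [∀ x, Module ℝ (V₁ x)] [FiberBundle F₁ V₁] [VectorBundle ℝ F₁ V₁]
  {E₂ : Type*} [NormedAddCommGroup E₂] [NormedSpace ℝ E₂]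
  {H₂ : Type*} [TopologicalSpace H₂] (I₂ : ModelWithCorners ℝ E₂ H₂)
  {M₂ : Type*} [TopologicalSpace M₂] [ChartedSpace H₂ M₂]
  (F₂ : Type*) [NormedAddCommGroup F₂] [NormedSpace ℝ F₂] (V₂ : M₂ → Type*)
  [TopologicalSpace (TotalSpace F₂ V₂)] [∀ x, TopologicalSpace (V₂ x)] [∀ x, AddCommGroup (V₂ x)]
  [∀ x, Module ℝ (V₂ x)] [FiberBundle F₂ V₂] [VectorBundle ℝ F₂ V₂]

/-- The vector bundle `V₁ × V₂ → M₁ × M₂`, with fibre `V₁ x × V₂ y` over `(x, y)`. -/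
abbrev ExternalProduct : M₁ × M₂ → Type _ :=
  ((ContMDiffMap.fst : C^∞⟮I₁.prod I₂, M₁ × M₂; I₁, M₁⟯) *ᵖ V₁) ×ᵇ
    ((ContMDiffMap.snd : C^∞⟮I₁.prod I₂, M₁ × M₂; I₂, M₂⟯) *ᵖ V₂)

variable {I₁ I₂ V₁ V₂}

/-- The direct product of skew algebroids. It is the bracket on `V₁ × V₂ → M₁ × M₂` for which
`[X₁ ⊞ X₂, Y₁ ⊞ Y₂] = [X₁, Y₁] ⊞ [X₂, Y₂]`, extended to all sections by the Leibniz rule for the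
anchor `ρ₁ × ρ₂`: at `(x, y)` the first component of `[Z, W]` is
`[Z₁(·, y), W₁(·, y)]₁ + ∂_{ρ₂(Z₂)} W₁(x, ·) - ∂_{ρ₂(W₂)} Z₁(x, ·)`. -/
def AlgebroidData.prod (A₁ : AlgebroidData I₁ V₁) (A₂ : AlgebroidData I₂ V₂) :
    AlgebroidData (I₁.prod I₂) (ExternalProduct I₁ V₁ I₂ V₂) where
  bracket Z W p :=
    (A₁.bracket (fun x => (Z (x, p.2)).1) (fun x => (W (x, p.2)).1) p.1
        + fibreDeriv F₁ V₁ I₂ p.1 (fun y => (W (p.1, y)).1) p.2 (A₂.anchor p.2 (Z p).2)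
        - fibreDeriv F₁ V₁ I₂ p.1 (fun y => (Z (p.1, y)).1) p.2 (A₂.anchor p.2 (W p).2),
      A₂.bracket (fun y => (Z (p.1, y)).2) (fun y => (W (p.1, y)).2) p.2
        + fibreDeriv F₂ V₂ I₁ p.2 (fun x => (W (x, p.2)).2) p.1 (A₁.anchor p.1 (Z p).1)
        - fibreDeriv F₂ V₂ I₁ p.2 (fun x => (Z (x, p.2)).2) p.1 (A₁.anchor p.1 (W p).1))
  anchor p := (A₁.anchor p.1).prodMap (A₂.anchor p.2)

/-- Skew algebroid morphism: a smooth vector bundle morphism `φ` over `f` whose graph, a subbundle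
over the graph of `f`, is a skew subalgebroid of the direct product. -/
structure IsSkewAlgebroidMorphism (A₁ : AlgebroidData I₁ V₁) (A₂ : AlgebroidData I₂ V₂)
    (f : M₁ → M₂) (φ : ∀ x, V₁ x →ₗ[ℝ] V₂ (f x)) : Prop where
  contMDiff_base : ContMDiff I₁ I₂ ∞ f
  contMDiff_total : ContMDiff (I₁.prod 𝓘(ℝ, F₁)) (I₂.prod 𝓘(ℝ, F₂)) ∞
    fun e : TotalSpace F₁ V₁ => (⟨f e.1, φ e.1 e.2⟩ : TotalSpace F₂ V₂)
  graph : IsSkewSubalgebroid (F₁ × F₂) I₁ (A₁.prod F₁ F₂ A₂) (fun x => (x, f x))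
    (fun x => (φ x).graph)

end Product

namespace SmoothQuasiloopoid

variable {EG : Type*} [NormedAddCommGroup EG] [NormedSpace ℝ EG]
  {G : Type*} [TopologicalSpace G] [ChartedSpace EG G]
  {EM : Type*} [NormedAddCommGroup EM] [NormedSpace ℝ EM]
  {M : Type*} [TopologicalSpace M] [ChartedSpace EM M]

/-- `A^l G`: bracket `[X, Y]_l(a) = [Xˡ, Yˡ](a)` modulo `T_a M`, where `Xˡ` is the left
prolongation of `X`, and anchor `Tβ (X̄^α)`. -/
def leftAlgebroid (Q : SmoothQuasiloopoid EG G EM M) :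
    AlgebroidData 𝓘(ℝ, EM) Q.NormalSpace where
  bracket X Y a := Q.normalMk a (VectorField.mlieBracket 𝓘(ℝ, EG)
    (Q.leftProlongation X) (Q.leftProlongation Y) (Q.unit a))
  anchor a := (mfderiv 𝓘(ℝ, EG) 𝓘(ℝ, EM) Q.source (Q.unit a)).toLinearMap ∘ₗ Q.leftRep a

/-- `A^r G`: bracket `[X, Y]_r(a) = [Xʳ, Yʳ](a)` modulo `T_a M`, where `Xʳ` is the right
prolongation of `X`, and anchor `Tα (X̄^β)`. -/
def rightAlgebroid (Q : SmoothQuasiloopoid EG G EM M) :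
    AlgebroidData 𝓘(ℝ, EM) Q.NormalSpace where
  bracket X Y a := Q.normalMk a (VectorField.mlieBracket 𝓘(ℝ, EG)
    (Q.rightProlongation X) (Q.rightProlongation Y) (Q.unit a))
  anchor a := (mfderiv 𝓘(ℝ, EG) 𝓘(ℝ, EM) Q.target (Q.unit a)).toLinearMap ∘ₗ Q.rightRep a

variable {EB : Type*} [NormedAddCommGroup EB] [NormedSpace ℝ EB]
  {B : Type*} [TopologicalSpace B] [ChartedSpace EB B]
  {EN : Type*} [NormedAddCommGroup EN] [NormedSpace ℝ EN]
  {N : Type*} [TopologicalSpace N] [ChartedSpace EN N]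

/-- Morphism of smooth quasiloopoids: a smooth map with `F (x y) = F x F y` whenever `x y` is
defined; in particular `F x F y` is then defined. -/
structure IsMorphism (Q : SmoothQuasiloopoid EB B EN N) (R : SmoothQuasiloopoid EG G EM M)
    (F : B → G) : Prop where
  contMDiff : ContMDiff 𝓘(ℝ, EB) 𝓘(ℝ, EG) ∞ F
  composable : ∀ x y, Q.source x = Q.target y → R.source (F x) = R.target (F y)
  map_mul : ∀ x y, Q.source x = Q.target y → F (Q.mul x y) = R.mul (F x) (F y)

/-- The map `φ : N → M` of units induced by `F`; see `IsMorphism.map_unit`. -/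
def baseMap (Q : SmoothQuasiloopoid EB B EN N) (R : SmoothQuasiloopoid EG G EM M)
    (F : B → G) (a : N) : M := R.target (F (Q.unit a))

namespace IsMorphism

variable {Q : SmoothQuasiloopoid EB B EN N} {R : SmoothQuasiloopoid EG G EM M} {F : B → G}

theorem map_unit (hF : Q.IsMorphism R F) (a : N) : F (Q.unit a) = R.unit (Q.baseMap R F a) := by
  have h : Q.source (Q.unit a) = Q.target (Q.unit a) := by rw [Q.source_unit, Q.target_unit]
  have h1 := hF.composable _ _ h
  have h2 := hF.map_mul _ _ h
  have h3 : Q.mul (Q.unit a) (Q.unit a) = Q.unit a := by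
    conv_lhs => rw [← Q.source_unit a]
    simpa only [Q.source_unit] using Q.mul_unit (Q.unit a)
  rw [h3] at h2
  have h4 := R.left_injOn (F (Q.unit a)) h1.symm
    (show R.unit (R.source (F (Q.unit a))) ∈ _ from R.target_unit _)
    (h2.symm.trans (R.mul_unit _).symm)
  rw [baseMap, ← h1]
  exact h4

theorem unitTangent_le (hF : Q.IsMorphism R F) (a : N) :
    Q.unitTangent a ≤ (R.unitTangent (Q.baseMap R F a)).comap
      (mfderiv 𝓘(ℝ, EB) 𝓘(ℝ, EG) F (Q.unit a)).toLinearMap := by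
  rintro _ ⟨u, rfl⟩
  have hε : MDifferentiableAt 𝓘(ℝ, EN) 𝓘(ℝ, EB) Q.unit a :=
    (Q.unit_embedding.contMDiff a).mdifferentiableAt (by simp)
  have hFd : MDifferentiableAt 𝓘(ℝ, EB) 𝓘(ℝ, EG) F (Q.unit a) :=
    (hF.contMDiff _).mdifferentiableAt (by simp)
  have hφ : MDifferentiableAt 𝓘(ℝ, EN) 𝓘(ℝ, EM) (Q.baseMap R F) a :=
    ((R.target_submersion.contMDiff _).comp a ((hF.contMDiff _).comp a
      (Q.unit_embedding.contMDiff a))).mdifferentiableAt (by simp)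
  have hε' : MDifferentiableAt 𝓘(ℝ, EM) 𝓘(ℝ, EG) R.unit (Q.baseMap R F a) :=
    (R.unit_embedding.contMDiff _).mdifferentiableAt (by simp)
  have h1 := hFd.hasMFDerivAt.comp a hε.hasMFDerivAt
  have h2 := hε'.hasMFDerivAt.comp a hφ.hasMFDerivAt
  have h3 : F ∘ Q.unit = R.unit ∘ Q.baseMap R F := funext hF.map_unit
  rw [← h3] at h2
  exact ⟨mfderiv 𝓘(ℝ, EN) 𝓘(ℝ, EM) (Q.baseMap R F) a u,
    (DFunLike.congr_fun (hasMFDerivAt_unique h1 h2) u).symm⟩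

/-- `AF` on fibres, `[v] ↦ [TF v]`. Its values lie over `φ a`, as `F (unit a) = unit (φ a)`. -/
def normalMap (hF : Q.IsMorphism R F) (a : N) :
    Q.NormalSpace a →ₗ[ℝ] R.NormalSpace (Q.baseMap R F a) :=
  (Q.unitTangent a).mapQ (R.unitTangent (Q.baseMap R F a))
    (mfderiv 𝓘(ℝ, EB) 𝓘(ℝ, EG) F (Q.unit a)).toLinearMap (hF.unitTangent_le a)

/-- `AF : AB → AG` as a map of total spaces. -/
def normalBundleMap (hF : Q.IsMorphism R F) (e : TotalSpace (NormalModel EB EN) Q.NormalSpace) :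
    TotalSpace (NormalModel EG EM) R.NormalSpace :=
  ⟨Q.baseMap R F e.1, hF.normalMap e.1 e.2⟩

theorem id (Q : SmoothQuasiloopoid EB B EN N) : Q.IsMorphism Q (fun x => x) :=
  ⟨contMDiff_id, fun _ _ h => h, fun _ _ _ => rfl⟩

theorem comp {EK : Type*} [NormedAddCommGroup EK] [NormedSpace ℝ EK]
    {K : Type*} [TopologicalSpace K] [ChartedSpace EK K]
    {EP : Type*} [NormedAddCommGroup EP] [NormedSpace ℝ EP]
    {P : Type*} [TopologicalSpace P] [ChartedSpace EP P]
    {S : SmoothQuasiloopoid EK K EP P} {F' : G → K}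
    (hF' : R.IsMorphism S F') (hF : Q.IsMorphism R F) : Q.IsMorphism S (F' ∘ F) :=
  ⟨hF'.contMDiff.comp hF.contMDiff,
    fun x y h => hF'.composable _ _ (hF.composable x y h),
    fun x y h => (congrArg F' (hF.map_mul x y h)).trans
      (hF'.map_mul _ _ (hF.composable x y h))⟩

end IsMorphism

end SmoothQuasiloopoid

end

/-! Left prolongation turns a section `X` of the normal bundle into a vector field on `G` whose
value at `g` depends only on `X (β g)`. Hence `fX` prolongs to `(f ∘ β)` times the prolongation of
`X`. At a unit the prolongation of `X` is the representative of `X` tangent to the `α`-fibre,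
because translation by a unit is the identity on that fibre. The bracket axioms of `A^l G` are then
those of vector fields, read at units and reduced modulo `TM`. The Leibniz rule acquires the
derivative of `f ∘ β` along the representative, which is `ρ_l(X)(f)`. Without associativity the
prolonged fields need not be closed under the bracket, so only a skew algebroid results. The right
structure is the left structure of the opposite quasiloopoid.

Two analytic points underlie this. The product is smooth only on the set of composable pairs, and
the `α`-fibres are generally not sets of unique differentiability. Both are settled by a smooth
family of local retractions onto the fibres of a submersion (`exists_fibre_retraction`). It extends
the product to an open set, and it shows that derivatives within a fibre are determined on `ker dα`.

For a morphism, differentiating `F ∘ l_g = l_{F g} ∘ F` along the `α`-fibre shows that prolongations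
are `F`-related. A section of `AB` need not be mapped to the restriction of a section of `AG`. It is
instead matched with a family `Z x` of sections of `AG` with parameter `x` in `N`, subject to `Z x
(f x) = φ (z x)`. The bracket formula for fields related to such a family
(`mfderiv_mlieBracket_of_related`, with parameter map `β`) has two further terms, the derivatives in
the parameter. Reduced to normal bundles it becomes `normalMap_left_bracket`.

A section of the product bundle is precisely a pair of such families. For sections tangent to the
graph, the formula for `F` identifies the second component of the product bracket with `φ [z, w]`.
The same formula for the identity of `B`, with the chain rule and the compatibility of anchors,
identifies the first component with `[z, w]`. Hence the bracket lies in the graph. Functoriality is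
the chain rule. -/

noncomputable section

open VectorField

/-! ### Smooth vectors along maps. -/

section Along
variable {E' : Type*} [NormedAddCommGroup E'] [NormedSpace ℝ E']
  {H' : Type*} [TopologicalSpace H'] {I' : ModelWithCorners ℝ E' H'}
  {P : Type*} [TopologicalSpace P] [ChartedSpace H' P]
  {EM : Type*} [NormedAddCommGroup EM] [NormedSpace ℝ EM]
  {HM : Type*} [TopologicalSpace HM] {I : ModelWithCorners ℝ EM HM}
  {M : Type*} [TopologicalSpace M] [ChartedSpace HM M]
  {F : Type*} [NormedAddCommGroup F] [NormedSpace ℝ F] {V : M → Type*}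
  [TopologicalSpace (TotalSpace F V)] [∀ x, TopologicalSpace (V x)] [∀ x, AddCommGroup (V x)]
  [∀ x, Module ℝ (V x)] [FiberBundle F V] [VectorBundle ℝ F V]

/-- Smoothness of the difference of two sections of a vector bundle along a map. -/
theorem ContMDiffAt.sub_along {n : WithTop ℕ∞} {m : P → M} {ξ η : ∀ p, V (m p)} {p₀ : P}
    (hξ : ContMDiffAt I' (I.prod 𝓘(ℝ, F)) n (fun p => (⟨m p, ξ p⟩ : TotalSpace F V)) p₀)
    (hη : ContMDiffAt I' (I.prod 𝓘(ℝ, F)) n (fun p => (⟨m p, η p⟩ : TotalSpace F V)) p₀) :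
    ContMDiffAt I' (I.prod 𝓘(ℝ, F)) n
      (fun p => (⟨m p, ξ p - η p⟩ : TotalSpace F V)) p₀ := by
  rw [contMDiffAt_totalSpace] at hξ hη ⊢
  refine ⟨hξ.1, (hξ.2.sub hη.2).congr_of_eventuallyEq ?_⟩
  have hb := hξ.1.continuousAt.preimage_mem_nhds
    ((trivializationAt F V (m p₀)).open_baseSet.mem_nhds
      (FiberBundle.mem_baseSet_trivializationAt' (m p₀)))
  filter_upwards [hb] with p hp
  exact ((trivializationAt F V (m p₀)).linear ℝ hp).map_sub (ξ p) (η p)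

variable {E'' : Type*} [NormedAddCommGroup E''] [NormedSpace ℝ E'']
  {H'' : Type*} [TopologicalSpace H''] {I'' : ModelWithCorners ℝ E'' H''}
  {M' : Type*} [TopologicalSpace M'] [ChartedSpace H'' M']

/-- Smooth dependence on parameters of the tangent map of a family of maps. -/
theorem ContMDiffAt.mfderiv_along [IsManifold I' ∞ P] [IsManifold I ∞ M] [IsManifold I'' ∞ M']
    {p₀ : P} {f : P → M → M'} {m : P → M}
    {v : ∀ p, TangentSpace I (m p)}
    (hf : ContMDiffAt (I'.prod I) I'' ∞ (Function.uncurry f) (p₀, m p₀))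
    (hv : ContMDiffAt I' I.tangent ∞ (fun p => (⟨m p, v p⟩ : TangentBundle I M)) p₀) :
    ContMDiffAt I' I''.tangent ∞
      (fun p => (⟨f p (m p), mfderiv I I'' (f p) (m p) (v p)⟩ : TangentBundle I'' M')) p₀ := by
  have hm : ContMDiffAt I' I ∞ m p₀ := (contMDiffAt_totalSpace.1 hv).1
  have h1 := ContMDiffAt.mfderiv (I := I) (I' := I'') (J := I') (m := ∞) (n := ∞) f m hf hm (by simp)
  have hb : ContMDiffAt I' I'' ∞ (fun p => f p (m p)) p₀ :=
    ContMDiffAt.comp (g := Function.uncurry f) p₀ hf (contMDiffAt_id.prodMk hm)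
  exact ContMDiffAt.clm_apply_of_inCoordinates (b₁ := m) (b₂ := fun p => f p (m p)) h1 hv hb

end Along

section VS
variable {E' : Type*} [NormedAddCommGroup E'] [NormedSpace ℝ E']
  {H' : Type*} [TopologicalSpace H'] {I' : ModelWithCorners ℝ E' H'}
  {P : Type*} [TopologicalSpace P] [ChartedSpace H' P]
  {F : Type*} [NormedAddCommGroup F] [NormedSpace ℝ F]

theorem contMDiffAt_tangentBundle_vectorSpace {n : WithTop ℕ∞} {m : P → F} {v : P → F} {p₀ : P} :
    ContMDiffAt I' 𝓘(ℝ, F).tangent n (fun p => (⟨m p, v p⟩ : TangentBundle 𝓘(ℝ, F) F)) p₀ ↔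
    ContMDiffAt I' 𝓘(ℝ, F) n m p₀ ∧ ContMDiffAt I' 𝓘(ℝ, F) n v p₀ := by
  rw [contMDiffAt_totalSpace]
  simp
end VS

/-! ### Lie brackets as commutators of derivations. -/

section Bracket
-- The product rule produces a second-derivative term `D²h(V, U)` in each summand. The two cancel by
-- symmetry of `D²h`, leaving `Dh (DU V - DV U)`.
theorem fderiv_lieBracket_apply {E E' : Type*} [NormedAddCommGroup E] [NormedSpace ℝ E]
    [NormedAddCommGroup E'] [NormedSpace ℝ E'] {h : E → E'} {V U : E → E} {x : E}
    (hh : ContDiffAt ℝ 2 h x) (hV : DifferentiableAt ℝ V x) (hU : DifferentiableAt ℝ U x) :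
    fderiv ℝ h x (lieBracket ℝ V U x) =
      fderiv ℝ (fun y => fderiv ℝ h y (U y)) x (V x) -
        fderiv ℝ (fun y => fderiv ℝ h y (V y)) x (U x) := by
  have hd : DifferentiableAt ℝ (fderiv ℝ h) x :=
    (hh.fderiv_right (m := 1) (by norm_num)).differentiableAt (by simp)
  have hs : IsSymmSndFDerivAt ℝ h x := hh.isSymmSndFDerivAt (by simp)
  rw [fderiv_clm_apply hd hU, fderiv_clm_apply hd hV, lieBracket_eq]
  simp [hs.eq (V x) (U x)]

variable {EG : Type*} [NormedAddCommGroup EG] [NormedSpace ℝ EG] [CompleteSpace EG]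
  {G : Type*} [TopologicalSpace G] [ChartedSpace EG G] [IsManifold 𝓘(ℝ, EG) ∞ G]
  {E' : Type*} [NormedAddCommGroup E'] [NormedSpace ℝ E']

/-- The vector field `V` read in the preferred chart at `u`. -/
def chartField (V : ∀ g : G, TangentSpace 𝓘(ℝ, EG) g) (u : G) : EG → EG :=
  mpullbackWithin 𝓘(ℝ, EG) 𝓘(ℝ, EG) (extChartAt 𝓘(ℝ, EG) u).symm V (range 𝓘(ℝ, EG))

omit [CompleteSpace EG] in
theorem mfderiv_extChartAt_apply (V : ∀ g : G, TangentSpace 𝓘(ℝ, EG) g) {u g : G}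
    (hg : g ∈ (extChartAt 𝓘(ℝ, EG) u).source) :
    mfderiv 𝓘(ℝ, EG) 𝓘(ℝ, EG) (extChartAt 𝓘(ℝ, EG) u) g (V g) =
      chartField V u (extChartAt 𝓘(ℝ, EG) u g) := by
  have : IsManifold 𝓘(ℝ, EG) 1 G := IsManifold.of_le (n := ∞) (by norm_num)
  -- The pullback inverts the derivative of the inverse chart and evaluates the field at `φ.symm (φ
  -- g)`. That point equals `g` only propositionally, so it is generalised before the inverse is
  -- identified with the derivative of the chart.
  have key : ∀ g' (hg' : g' = g), (mfderivWithin 𝓘(ℝ, EG) 𝓘(ℝ, EG) (extChartAt 𝓘(ℝ, EG) u).symm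
      (range 𝓘(ℝ, EG)) (extChartAt 𝓘(ℝ, EG) u g)).inverse (V g') =
      mfderiv 𝓘(ℝ, EG) 𝓘(ℝ, EG) (extChartAt 𝓘(ℝ, EG) u) g (V g) := by
    rintro _ rfl
    refine DFunLike.congr_fun (ContinuousLinearMap.inverse_eq
      (mfderivWithin_extChartAt_symm_comp_mfderiv_extChartAt' hg) ?_) (V _)
    have h := mfderiv_extChartAt_comp_mfderivWithin_extChartAt_symm
      (I := 𝓘(ℝ, EG)) ((extChartAt 𝓘(ℝ, EG) u).map_source hg)
    rw [(extChartAt 𝓘(ℝ, EG) u).left_inv hg] at h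
    exact h
  exact (key _ ((extChartAt 𝓘(ℝ, EG) u).left_inv hg)).symm

theorem differentiableAt_chartField {V : ∀ g : G, TangentSpace 𝓘(ℝ, EG) g} {u : G}
    (hV : ContMDiffAt 𝓘(ℝ, EG) 𝓘(ℝ, EG).tangent ∞
      (fun g => (⟨g, V g⟩ : TangentBundle 𝓘(ℝ, EG) G)) u) :
    DifferentiableAt ℝ (chartField V u) (extChartAt 𝓘(ℝ, EG) u u) := by
  have : IsManifold 𝓘(ℝ, EG) 2 G := IsManifold.of_le (n := ∞) (ENat.LEInfty.out)
  have h1 := (hV.mdifferentiableAt (by simp)).mdifferentiableWithinAt (s := univ)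
  have := MDifferentiableWithinAt.differentiableWithinAt_mpullbackWithin_vectorField h1
  rw [preimage_univ, univ_inter] at this
  exact this.differentiableAt (by
    rw [ModelWithCorners.Boundaryless.range_eq_univ]; exact Filter.univ_mem)

omit [CompleteSpace EG] in
theorem mfderiv_extChartAt_mlieBracket (V U : ∀ g : G, TangentSpace 𝓘(ℝ, EG) g) (u : G) :
    mfderiv 𝓘(ℝ, EG) 𝓘(ℝ, EG) (extChartAt 𝓘(ℝ, EG) u) u (mlieBracket 𝓘(ℝ, EG) V U u) =
      lieBracket ℝ (chartField V u) (chartField U u) (extChartAt 𝓘(ℝ, EG) u u) := by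
  have : IsManifold 𝓘(ℝ, EG) 1 G := IsManifold.of_le (n := ∞) (by norm_num)
  rw [← mlieBracketWithin_univ, mlieBracketWithin_apply]
  have hi := isInvertible_mfderiv_extChartAt (I := 𝓘(ℝ, EG)) (mem_extChartAt_source (I := 𝓘(ℝ, EG)) u)
  refine (hi.self_apply_inverse _).trans ?_
  have hr : (extChartAt 𝓘(ℝ, EG) u).symm ⁻¹' univ ∩ range 𝓘(ℝ, EG) = univ := by simp
  rw [hr]
  exact congrFun (lieBracketWithin_univ (𝕜 := ℝ) (E := EG)) (extChartAt 𝓘(ℝ, EG) u u)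

/-- Vector fields act on functions as derivations, with bracket the commutator. -/
theorem mfderiv_mlieBracket_apply {V U : ∀ g : G, TangentSpace 𝓘(ℝ, EG) g} {u : G}
    (hV : ContMDiffAt 𝓘(ℝ, EG) 𝓘(ℝ, EG).tangent ∞
      (fun g => (⟨g, V g⟩ : TangentBundle 𝓘(ℝ, EG) G)) u)
    (hU : ContMDiffAt 𝓘(ℝ, EG) 𝓘(ℝ, EG).tangent ∞
      (fun g => (⟨g, U g⟩ : TangentBundle 𝓘(ℝ, EG) G)) u)
    {h : G → E'} (hh : ContMDiffAt 𝓘(ℝ, EG) 𝓘(ℝ, E') ∞ h u) :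
    mvfderiv 𝓘(ℝ, EG) h u (mlieBracket 𝓘(ℝ, EG) V U u) =
      mvfderiv 𝓘(ℝ, EG) (fun g => mvfderiv 𝓘(ℝ, EG) h g (U g)) u (V u) -
        mvfderiv 𝓘(ℝ, EG) (fun g => mvfderiv 𝓘(ℝ, EG) h g (V g)) u (U u) := by
  have : IsManifold 𝓘(ℝ, EG) 1 G := IsManifold.of_le (n := ∞) (by norm_num)
  set φ := extChartAt 𝓘(ℝ, EG) u with hφ
  have hus : u ∈ φ.source := mem_extChartAt_source u
  -- With `h` read in the chart as `k`, every derivative below becomes a Frechet derivative of `k`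
  -- along chart fields, and the vector space formula applies.
  set k : EG → E' := h ∘ φ.symm with hk
  have hkc : ContDiffAt ℝ ∞ k (φ u) := by
    rw [← contMDiffAt_iff_contDiffAt]
    refine ContMDiffAt.comp (φ u) ?_ (contMDiffOn_extChartAt_symm u |>.contMDiffAt
      (extChartAt_target_mem_nhds u))
    rwa [φ.left_inv hus]
  have hmem : ∀ᶠ g in 𝓝 u, g ∈ φ.source := extChartAt_source_mem_nhds u
  have hφd : ∀ g ∈ φ.source, MDifferentiableAt 𝓘(ℝ, EG) 𝓘(ℝ, EG) φ g :=
    fun g hg => mdifferentiableAt_extChartAt (by simpa [hφ] using hg)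
  have hkd : ∀ᶠ g in 𝓝 u, DifferentiableAt ℝ k (φ g) :=
    (continuousAt_extChartAt (I := 𝓘(ℝ, EG)) u).eventually
      (((hkc.of_le (m := 1) (by norm_num)).eventually (by simp)).mono
        fun y hy => hy.differentiableAt (by simp))
  have hder : ∀ᶠ g in 𝓝 u, ∀ X : TangentSpace 𝓘(ℝ, EG) g, mvfderiv 𝓘(ℝ, EG) h g X =
      fderiv ℝ k (φ g) (mfderiv 𝓘(ℝ, EG) 𝓘(ℝ, EG) φ g X) := by
    filter_upwards [eventually_eventually_nhds.2 hmem, hkd] with g hg hg'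
    intro X
    have e : h =ᶠ[𝓝 g] k ∘ φ := by
      filter_upwards [hg] with g' hg'
      simp [hk, φ.left_inv hg']
    have h2 := (hg'.mdifferentiableAt.hasMFDerivAt.comp g
      (hφd g hg.self_of_nhds).hasMFDerivAt).congr_of_eventuallyEq e
    rw [mvfderiv, h2.mfderiv, mfderiv_eq_fderiv]
    rfl
  have hd : DifferentiableAt ℝ (fderiv ℝ k) (φ u) :=
    ((hkc.of_le (m := 2) ENat.LEInfty.out).fderiv_right (m := 1) (by norm_num)).differentiableAt (by simp)
  have hfield : ∀ X Y : (∀ g : G, TangentSpace 𝓘(ℝ, EG) g), ContMDiffAt 𝓘(ℝ, EG) 𝓘(ℝ, EG).tangent ∞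
      (fun g => (⟨g, X g⟩ : TangentBundle 𝓘(ℝ, EG) G)) u →
      mvfderiv 𝓘(ℝ, EG) (fun g => mvfderiv 𝓘(ℝ, EG) h g (X g)) u (Y u) =
      fderiv ℝ (fun y => fderiv ℝ k y (chartField X u y)) (φ u) (chartField Y u (φ u)) := by
    intro X Y hX
    have hdX := differentiableAt_chartField hX
    have e : (fun g => mvfderiv 𝓘(ℝ, EG) h g (X g)) =ᶠ[𝓝 u]
        (fun y => fderiv ℝ k y (chartField X u y)) ∘ φ := by
      filter_upwards [hder, hmem] with g hg hg'
      exact (hg (X g)).trans (congrArg _ (mfderiv_extChartAt_apply X hg'))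
    have h2 := ((hd.clm_apply hdX).mdifferentiableAt.hasMFDerivAt.comp u
      (hφd u hus).hasMFDerivAt).congr_of_eventuallyEq e
    rw [mvfderiv, h2.mfderiv, mfderiv_eq_fderiv, ← mfderiv_extChartAt_apply Y hus]
    rfl
  rw [hfield U V hU, hfield V U hV, hder.self_of_nhds, mfderiv_extChartAt_mlieBracket]
  exact fderiv_lieBracket_apply (hkc.of_le (ENat.LEInfty.out))
    (differentiableAt_chartField hV) (differentiableAt_chartField hU)

end Bracket

/-! ### Brackets of fields related to a family of fields. -/

section Related

variable {EB : Type*} [NormedAddCommGroup EB] [NormedSpace ℝ EB]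
  {B : Type*} [TopologicalSpace B] [ChartedSpace EB B]
  {EN : Type*} [NormedAddCommGroup EN] [NormedSpace ℝ EN]
  {N : Type*} [TopologicalSpace N] [ChartedSpace EN N]
  {EG : Type*} [NormedAddCommGroup EG] [NormedSpace ℝ EG]
  {G : Type*} [TopologicalSpace G] [ChartedSpace EG G]
  {E' : Type*} [NormedAddCommGroup E'] [NormedSpace ℝ E']

theorem HasMFDerivAt.mvfderiv_apply {h : B → E'} {b : B} {A : TangentSpace 𝓘(ℝ, EB) b →L[ℝ] E'}
    (hA : HasMFDerivAt 𝓘(ℝ, EB) 𝓘(ℝ, E') h b A) (X : TangentSpace 𝓘(ℝ, EB) b) :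
    mvfderiv 𝓘(ℝ, EB) h b X = A X :=
  DFunLike.congr_fun hA.mfderiv X

theorem mvfderiv_comp_prodMk {H : N × G → E'} {p : B → N} {F : B → G} {e : B}
    (hH : MDifferentiableAt (𝓘(ℝ, EN).prod 𝓘(ℝ, EG)) 𝓘(ℝ, E') H (p e, F e))
    (hp : MDifferentiableAt 𝓘(ℝ, EB) 𝓘(ℝ, EN) p e) (hF : MDifferentiableAt 𝓘(ℝ, EB) 𝓘(ℝ, EG) F e)
    (X : TangentSpace 𝓘(ℝ, EB) e) :
    mvfderiv 𝓘(ℝ, EB) (fun b => H (p b, F b)) e X =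
      mvfderiv 𝓘(ℝ, EN) (fun x => H (x, F e)) (p e) (mfderiv 𝓘(ℝ, EB) 𝓘(ℝ, EN) p e X) +
        mvfderiv 𝓘(ℝ, EG) (fun g => H (p e, g)) (F e) (mfderiv 𝓘(ℝ, EB) 𝓘(ℝ, EG) F e X) := by
  have h1 := hH.hasMFDerivAt.comp (f := fun b => (p b, F b)) e
    (hp.hasMFDerivAt.prodMk hF.hasMFDerivAt)
  refine (HasMFDerivAt.mvfderiv_apply h1 X).trans ?_
  exact mfderiv_prod_eq_add_apply hH

theorem mvfderiv_clm_comp {E'' : Type*} [NormedAddCommGroup E''] [NormedSpace ℝ E'']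
    (A : E' →L[ℝ] E'') {h : B → E'} {b : B}
    (hh : MDifferentiableAt 𝓘(ℝ, EB) 𝓘(ℝ, E') h b) (X : TangentSpace 𝓘(ℝ, EB) b) :
    mvfderiv 𝓘(ℝ, EB) (fun b => A (h b)) b X = A (mvfderiv 𝓘(ℝ, EB) h b X) :=
  HasMFDerivAt.mvfderiv_apply (A.hasMFDerivAt.comp b hh.hasMFDerivAt) X

variable [IsManifold 𝓘(ℝ, EB) ∞ B] [IsManifold 𝓘(ℝ, EN) ∞ N] [IsManifold 𝓘(ℝ, EG) ∞ G]
  [CompleteSpace EB] [CompleteSpace EG]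

/-- Derivative of a map into a fixed tangent space. -/
def tangentDeriv {u : G} (s : N → TangentSpace 𝓘(ℝ, EG) u) (x : N) (v : TangentSpace 𝓘(ℝ, EN) x) :
    TangentSpace 𝓘(ℝ, EG) u :=
  mvfderiv (F := EG) 𝓘(ℝ, EN) s x v

/-- The bracket of vector fields related, along a map `F`, to vector fields depending on a
parameter. -/
theorem mfderiv_mlieBracket_of_related {F : B → G} {p : B → N} {e : B}
    (hF : ContMDiff 𝓘(ℝ, EB) 𝓘(ℝ, EG) ∞ F) (hp : ContMDiffAt 𝓘(ℝ, EB) 𝓘(ℝ, EN) ∞ p e)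
    {z w : ∀ b : B, TangentSpace 𝓘(ℝ, EB) b}
    (hz : ContMDiffAt 𝓘(ℝ, EB) 𝓘(ℝ, EB).tangent ∞
      (fun b => (⟨b, z b⟩ : TangentBundle 𝓘(ℝ, EB) B)) e)
    (hw : ContMDiffAt 𝓘(ℝ, EB) 𝓘(ℝ, EB).tangent ∞
      (fun b => (⟨b, w b⟩ : TangentBundle 𝓘(ℝ, EB) B)) e)
    {V U : N → ∀ g : G, TangentSpace 𝓘(ℝ, EG) g}
    (hV : ContMDiffAt (𝓘(ℝ, EN).prod 𝓘(ℝ, EG)) 𝓘(ℝ, EG).tangent ∞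
      (fun q : N × G => (⟨q.2, V q.1 q.2⟩ : TangentBundle 𝓘(ℝ, EG) G)) (p e, F e))
    (hU : ContMDiffAt (𝓘(ℝ, EN).prod 𝓘(ℝ, EG)) 𝓘(ℝ, EG).tangent ∞
      (fun q : N × G => (⟨q.2, U q.1 q.2⟩ : TangentBundle 𝓘(ℝ, EG) G)) (p e, F e))
    (hzV : ∀ b, mfderiv 𝓘(ℝ, EB) 𝓘(ℝ, EG) F b (z b) = V (p b) (F b))
    (hwU : ∀ b, mfderiv 𝓘(ℝ, EB) 𝓘(ℝ, EG) F b (w b) = U (p b) (F b)) :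
    mfderiv 𝓘(ℝ, EB) 𝓘(ℝ, EG) F e (mlieBracket 𝓘(ℝ, EB) z w e) =
      mlieBracket 𝓘(ℝ, EG) (V (p e)) (U (p e)) (F e) +
        tangentDeriv (fun x => U x (F e)) (p e) (mfderiv 𝓘(ℝ, EB) 𝓘(ℝ, EN) p e (z e)) -
        tangentDeriv (fun x => V x (F e)) (p e) (mfderiv 𝓘(ℝ, EB) 𝓘(ℝ, EN) p e (w e)) := by
  have : IsManifold 𝓘(ℝ, EG) 1 G := IsManifold.of_le (n := ∞) (by norm_num)
  -- Both sides are tested against the chart `h` at `F e`, whose differential there is injective;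
  -- brackets then become commutators of derivatives of `h` and `h ∘ F`.
  set h : G → EG := ⇑(extChartAt 𝓘(ℝ, EG) (F e)) with hh
  have hhs : ContMDiffAt 𝓘(ℝ, EG) 𝓘(ℝ, EG) ∞ h (F e) := contMDiffAt_extChartAt
  let A : EG →L[ℝ] EG := mfderiv 𝓘(ℝ, EG) 𝓘(ℝ, EG) h (F e)
  obtain ⟨A', hA'⟩ : A.IsInvertible := isInvertible_mfderiv_extChartAt (mem_extChartAt_source (F e))
  have hAinj : Function.Injective A := by rw [← hA']; exact A'.injective
  have hFd := (hF e).mdifferentiableAt (by simp)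
  have hpd := hp.mdifferentiableAt (by simp)
  have hhd : ∀ᶠ g in 𝓝 (F e), MDifferentiableAt 𝓘(ℝ, EG) 𝓘(ℝ, EG) h g := by
    filter_upwards [extChartAt_source_mem_nhds (I := 𝓘(ℝ, EG)) (F e)] with g hg
    exact mdifferentiableAt_extChartAt (by simpa using hg)
  have hcomp : ∀ᶠ b in 𝓝 e, ∀ X : TangentSpace 𝓘(ℝ, EB) b, mvfderiv 𝓘(ℝ, EB) (h ∘ F) b X =
      mvfderiv 𝓘(ℝ, EG) h (F b) (mfderiv 𝓘(ℝ, EB) 𝓘(ℝ, EG) F b X) := by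
    filter_upwards [hF.continuous.continuousAt.eventually hhd] with b hb X
    exact HasMFDerivAt.mvfderiv_apply (hb.hasMFDerivAt.comp b ((hF b).mdifferentiableAt (by simp)).hasMFDerivAt) X
  -- The derivative of `h ∘ F` along `y` is `H (p b, F b)` with `H (x, g) = dh (Y x g)`.
  -- Differentiating through the two arguments separates the dependence on the parameter from the
  -- ordinary derivative on `G`.
  have key : ∀ (y : ∀ b : B, TangentSpace 𝓘(ℝ, EB) b) (Y : N → ∀ g : G, TangentSpace 𝓘(ℝ, EG) g),
      ContMDiffAt (𝓘(ℝ, EN).prod 𝓘(ℝ, EG)) 𝓘(ℝ, EG).tangent ∞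
        (fun q : N × G => (⟨q.2, Y q.1 q.2⟩ : TangentBundle 𝓘(ℝ, EG) G)) (p e, F e) →
      (∀ b, mfderiv 𝓘(ℝ, EB) 𝓘(ℝ, EG) F b (y b) = Y (p b) (F b)) →
      ∀ X : TangentSpace 𝓘(ℝ, EB) e,
      mvfderiv 𝓘(ℝ, EB) (fun b => mvfderiv 𝓘(ℝ, EB) (h ∘ F) b (y b)) e X =
        A (tangentDeriv (fun x => Y x (F e)) (p e)
            (mfderiv 𝓘(ℝ, EB) 𝓘(ℝ, EN) p e X)) +
          mvfderiv 𝓘(ℝ, EG) (fun g => mvfderiv 𝓘(ℝ, EG) h g (Y (p e) g)) (F e)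
            (mfderiv 𝓘(ℝ, EB) 𝓘(ℝ, EG) F e X) := by
    intro y Y hY hyY X
    have hH : ContMDiffAt (𝓘(ℝ, EN).prod 𝓘(ℝ, EG)) 𝓘(ℝ, EG) ∞
        (fun q : N × G => mvfderiv 𝓘(ℝ, EG) h q.2 (Y q.1 q.2)) (p e, F e) :=
      (contMDiffAt_tangentBundle_vectorSpace.1
        (ContMDiffAt.mfderiv_along (f := fun _ => h) (m := fun q : N × G => q.2)
          (hhs.comp (f := Prod.snd) (_, _) contMDiffAt_snd) hY)).2
    have hHd := hH.mdifferentiableAt (by simp)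
    have h1 : (fun b => mvfderiv 𝓘(ℝ, EB) (h ∘ F) b (y b)) =ᶠ[𝓝 e]
        fun b => mvfderiv 𝓘(ℝ, EG) h (F b) (Y (p b) (F b)) := by
      filter_upwards [hcomp] with b hb
      rw [hb, hyY]
    have h2 : mvfderiv 𝓘(ℝ, EB) (fun b => mvfderiv 𝓘(ℝ, EB) (h ∘ F) b (y b)) e X =
        mvfderiv 𝓘(ℝ, EB) (fun b => mvfderiv 𝓘(ℝ, EG) h (F b) (Y (p b) (F b))) e X :=
      DFunLike.congr_fun h1.mfderiv_eq X
    rw [h2, mvfderiv_comp_prodMk hHd hpd hFd]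
    congr 1
    have hd : MDifferentiableAt 𝓘(ℝ, EN) 𝓘(ℝ, EG)
        (fun x => mvfderiv 𝓘(ℝ, EG) h (F e) (Y x (F e))) (p e) :=
      hHd.comp (f := fun x => (x, F e)) (p e)
        (mdifferentiableAt_id.prodMk mdifferentiableAt_const)
    -- Smoothness of `Y` is known only as a map into the tangent bundle. Differentiability in the
    -- fixed tangent space at `F e` is recovered by applying the inverse of `dh` there.
    have hd' : MDifferentiableAt (M' := EG) 𝓘(ℝ, EN) 𝓘(ℝ, EG) (fun x => Y x (F e)) (p e) := by
      have h3 := (A'.symm : EG →L[ℝ] EG).mdifferentiableAt.comp (p e) hd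
      refine h3.congr_of_eventuallyEq (Filter.Eventually.of_forall fun x => ?_)
      refine (A'.symm_apply_apply _).symm.trans (congrArg A'.symm ?_)
      exact DFunLike.congr_fun hA' _
    exact mvfderiv_clm_comp A hd' _
  have hslice : ∀ (Y : N → ∀ g : G, TangentSpace 𝓘(ℝ, EG) g),
      ContMDiffAt (𝓘(ℝ, EN).prod 𝓘(ℝ, EG)) 𝓘(ℝ, EG).tangent ∞
        (fun q : N × G => (⟨q.2, Y q.1 q.2⟩ : TangentBundle 𝓘(ℝ, EG) G)) (p e, F e) →
      ContMDiffAt 𝓘(ℝ, EG) 𝓘(ℝ, EG).tangent ∞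
        (fun g => (⟨g, Y (p e) g⟩ : TangentBundle 𝓘(ℝ, EG) G)) (F e) := fun Y hY =>
    hY.comp (f := fun g => (p e, g)) (F e) (contMDiffAt_const.prodMk contMDiffAt_id)
  apply hAinj
  have e1 : A (mfderiv 𝓘(ℝ, EB) 𝓘(ℝ, EG) F e (mlieBracket 𝓘(ℝ, EB) z w e)) =
      mvfderiv 𝓘(ℝ, EB) (h ∘ F) e (mlieBracket 𝓘(ℝ, EB) z w e) := (hcomp.self_of_nhds _).symm
  have e2 := mfderiv_mlieBracket_apply (hslice V hV) (hslice U hU) hhs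
  refine e1.trans ?_
  rw [mfderiv_mlieBracket_apply hz hw (hhs.comp e (hF e)), key w U hU hwU, key z V hV hzV, hzV, hwU]
  have e3 : ∀ a b c : EG, A (a + b - c) = A a + A b - A c := fun a b c => by
    rw [map_sub, map_add]
  refine Eq.symm ((e3 _ _ _).trans ?_)
  have e4 : A (mlieBracket 𝓘(ℝ, EG) (V (p e)) (U (p e)) (F e)) = _ := e2
  rw [e4]
  abel

end Related

/-! ### Retractions onto the fibres of a submersion. -/

section Retraction

variable {EG : Type*} [NormedAddCommGroup EG] [NormedSpace ℝ EG]
  {G : Type*} [TopologicalSpace G] [ChartedSpace EG G]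
  {EM : Type*} [NormedAddCommGroup EM] [NormedSpace ℝ EM]
  {M : Type*} [TopologicalSpace M] [ChartedSpace EM M]

/-- Near `h₀`, a submersion admits a smooth family of retractions onto its fibres. -/
theorem Manifold.IsSubmersion.exists_fibre_retraction [IsManifold 𝓘(ℝ, EG) ∞ G]
    [IsManifold 𝓘(ℝ, EM) ∞ M] {α : G → M}
    (hα : IsSubmersion 𝓘(ℝ, EG) 𝓘(ℝ, EM) ∞ α) (h₀ : G) :
    ∃ (r : M × G → G) (W : Set (M × G)), IsOpen W ∧ (α h₀, h₀) ∈ W ∧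
      ContMDiffOn (𝓘(ℝ, EM).prod 𝓘(ℝ, EG)) 𝓘(ℝ, EG) ∞ r W ∧
      (∀ q ∈ W, α (r q) = q.1) ∧ ∀ h, (α h, h) ∈ W → r (α h, h) = h := by
  have hs := hα.isSubmersionAt h₀
  let φ : OpenPartialHomeomorph G EG := hs.domChart
  let ψ : OpenPartialHomeomorph M EM := hs.codChart
  let e := hs.equiv
  have hφs : h₀ ∈ φ.source := hs.mem_domChart_source
  have hψs : α h₀ ∈ ψ.source := hs.mem_codChart_source
  have hsub : φ.source ⊆ α ⁻¹' ψ.source := hs.source_subset_preimage_source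
  have hw : ∀ g ∈ φ.source, ψ (α g) = (e (φ g)).1 := by
    intro g hg
    have hx : φ g ∈ (hs.domChart.extend 𝓘(ℝ, EG)).target := by
      simpa using φ.map_source hg
    have h := hs.writtenInCharts hx
    have h' : hs.domChart.symm (φ g) = g := φ.left_inv hg
    simpa [h'] using h
  have hφ : ContMDiffOn 𝓘(ℝ, EG) 𝓘(ℝ, EG) ∞ φ φ.source :=
    contMDiffOn_of_mem_maximalAtlas hs.domChart_mem_maximalAtlas
  have hφ' : ContMDiffOn 𝓘(ℝ, EG) 𝓘(ℝ, EG) ∞ φ.symm φ.target :=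
    contMDiffOn_symm_of_mem_maximalAtlas hs.domChart_mem_maximalAtlas
  have hψ : ContMDiffOn 𝓘(ℝ, EM) 𝓘(ℝ, EM) ∞ ψ ψ.source :=
    contMDiffOn_of_mem_maximalAtlas hs.codChart_mem_maximalAtlas
  -- In submersion charts `α` is the first projection. Replacing the first coordinate of `h` by that
  -- of `x` moves `h` to the fibre over `x`; `W` consists of the pairs for which the result stays in
  -- the chart.
  let c : M × G → EG := fun q => e.symm (ψ q.1, (e (φ q.2)).2)
  have hc : ContMDiffOn (𝓘(ℝ, EM).prod 𝓘(ℝ, EG)) 𝓘(ℝ, EG) ∞ c (ψ.source ×ˢ φ.source) := by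
    have h1 : ContMDiffOn (𝓘(ℝ, EM).prod 𝓘(ℝ, EG)) 𝓘(ℝ, EM) ∞ (fun q : M × G => ψ q.1)
        (ψ.source ×ˢ φ.source) :=
      hψ.comp (f := Prod.fst) contMDiffOn_fst fun q hq => hq.1
    have h2 : ContMDiffOn (𝓘(ℝ, EM).prod 𝓘(ℝ, EG)) 𝓘(ℝ, EG) ∞ (fun q : M × G => φ q.2)
        (ψ.source ×ˢ φ.source) :=
      hφ.comp (f := Prod.snd) contMDiffOn_snd fun q hq => hq.2
    have h3 : ContMDiff (𝓘(ℝ, EM × EG)) 𝓘(ℝ, EG) ∞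
        (fun q : EM × EG => e.symm (q.1, (e q.2).2)) := by
      rw [contMDiff_iff_contDiff]
      fun_prop
    exact h3.comp_contMDiffOn (h1.prodMk_space h2)
  have hcφ : ∀ h ∈ φ.source, c (α h, h) = φ h := by
    intro h hh
    change e.symm (ψ (α h), (e (φ h)).2) = φ h
    rw [hw h hh]
    exact e.symm_apply_apply _
  refine ⟨fun q => φ.symm (c q), (ψ.source ×ˢ φ.source) ∩ c ⁻¹' φ.target,
    hc.continuousOn.isOpen_inter_preimage (ψ.open_source.prod φ.open_source) φ.open_target,
    ⟨⟨hψs, hφs⟩, ?_⟩, hφ'.comp (hc.mono inter_subset_left) fun q hq => hq.2, ?_, ?_⟩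
  · rw [mem_preimage, hcφ _ hφs]
    exact φ.map_source hφs
  · rintro q ⟨⟨hq1, hq2⟩, hq3⟩
    have hr := φ.map_target hq3
    refine ψ.injOn (hsub hr) hq1 ?_
    rw [hw _ hr, φ.right_inv hq3]
    simp [c]
  · rintro h ⟨⟨-, hh⟩, -⟩
    exact (congrArg φ.symm (hcφ h hh)).trans (φ.left_inv hh)

/-- A smooth family of retractions onto the fibres of `α` has the identity as derivative along
the fibres. -/
theorem mfderiv_fibre_retraction {α : G → M} (hα : ContMDiff 𝓘(ℝ, EG) 𝓘(ℝ, EM) ∞ α)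
    {r : M × G → G} {W : Set (M × G)} (hWo : IsOpen W)
    (hr : ContMDiffOn (𝓘(ℝ, EM).prod 𝓘(ℝ, EG)) 𝓘(ℝ, EG) ∞ r W)
    (hrα : ∀ h, (α h, h) ∈ W → r (α h, h) = h) {h : G} (hW : (α h, h) ∈ W) :
    MDifferentiableAt 𝓘(ℝ, EG) 𝓘(ℝ, EG) (fun k => r (α h, k)) h ∧
    ∀ v : TangentSpace 𝓘(ℝ, EG) h, mfderiv 𝓘(ℝ, EG) 𝓘(ℝ, EM) α h v = 0 →
      @Eq EG (mfderiv 𝓘(ℝ, EG) 𝓘(ℝ, EG) (fun k => r (α h, k)) h v) v := by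
  have hrd : MDifferentiableAt (𝓘(ℝ, EM).prod 𝓘(ℝ, EG)) 𝓘(ℝ, EG) r (α h, h) :=
    (hr.contMDiffAt (hWo.mem_nhds hW)).mdifferentiableAt (by simp)
  have hev : ∀ᶠ k in 𝓝 h, (α k, k) ∈ W :=
    (hα.continuous.prodMk continuous_id).continuousAt (hWo.mem_nhds hW)
  refine ⟨hrd.comp (f := fun k => (α h, k)) h
    (mdifferentiableAt_const.prodMk mdifferentiableAt_id), fun v hv => ?_⟩
  -- Differentiate `r (α k, k) = k` at `h` in the direction `v`: the partial derivative in the first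
  -- slot is applied to `dα v = 0`, so the one in the second slot fixes `v`.
  have h1 := hrd.hasMFDerivAt.comp (f := fun k => (α k, k)) h
    (((hα h).mdifferentiableAt (by simp)).hasMFDerivAt.prodMk (hasMFDerivAt_id h))
  have h2 : HasMFDerivAt 𝓘(ℝ, EG) 𝓘(ℝ, EG) (r ∘ fun k => (α k, k)) h
      (ContinuousLinearMap.id ℝ _) :=
    (hasMFDerivAt_id h).congr_of_eventuallyEq (hev.mono fun k hk => hrα k hk)
  have h3 := DFunLike.congr_fun (hasMFDerivAt_unique h1 h2) v
  have h4 : mfderiv (𝓘(ℝ, EM).prod 𝓘(ℝ, EG)) 𝓘(ℝ, EG) r (α h, h)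
      (mfderiv 𝓘(ℝ, EG) 𝓘(ℝ, EM) α h v, v) = v := h3
  rw [hv] at h4
  have h5 := (mfderiv_prod_eq_add_apply (v := ((0, v) : EM × EG)) hrd).symm.trans h4
  have h6 : mfderiv 𝓘(ℝ, EM) 𝓘(ℝ, EG) (fun z => r (z, h)) (α h) 0 = 0 :=
    map_zero (mfderiv 𝓘(ℝ, EM) 𝓘(ℝ, EG) (fun z => r (z, h)) (α h))
  have h7 : ∀ a b c : EG, a = 0 → a + b = c → b = c := fun a b c ha hab => by
    rw [ha, zero_add] at hab
    exact hab
  exact h7 _ _ _ h6 h5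

/-- The derivative within a fibre of a submersion is determined on the vectors tangent to the
fibre. -/
theorem Manifold.IsSubmersion.hasMFDerivWithinAt_fibre_unique [IsManifold 𝓘(ℝ, EG) ∞ G]
    [IsManifold 𝓘(ℝ, EM) ∞ M] {α : G → M}
    (hα : IsSubmersion 𝓘(ℝ, EG) 𝓘(ℝ, EM) ∞ α)
    {E' : Type*} [NormedAddCommGroup E'] [NormedSpace ℝ E']
    {X : Type*} [TopologicalSpace X] [ChartedSpace E' X] {f : G → X} {b : M} {h : G}
    {A A' : TangentSpace 𝓘(ℝ, EG) h →L[ℝ] TangentSpace 𝓘(ℝ, E') (f h)}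
    (hA : HasMFDerivWithinAt 𝓘(ℝ, EG) 𝓘(ℝ, E') f {k | α k = b} h A)
    (hA' : HasMFDerivWithinAt 𝓘(ℝ, EG) 𝓘(ℝ, E') f {k | α k = b} h A') (hb : α h = b)
    {v : TangentSpace 𝓘(ℝ, EG) h} (hv : mfderiv 𝓘(ℝ, EG) 𝓘(ℝ, EM) α h v = 0) : A v = A' v := by
  subst hb
  obtain ⟨r, W, hWo, hW0, hr, hαr, hrα⟩ := hα.exists_fibre_retraction h
  obtain ⟨hd, hfix⟩ := mfderiv_fibre_retraction hα.contMDiff hWo hr hrα hW0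
  have hrh := hrα h hW0
  have hev : ∀ᶠ k in 𝓝 h, α (r (α h, k)) = α h := by
    have : ∀ᶠ k in 𝓝 h, (α h, k) ∈ W :=
      (continuous_const.prodMk continuous_id).continuousAt (hWo.mem_nhds hW0)
    exact this.mono fun k hk => hαr _ hk
  -- Composition with the retraction turns a derivative within the fibre into a derivative on a
  -- neighbourhood, where uniqueness holds. The retraction fixes `v` to first order, so nothing is
  -- lost on `v`.
  have key : ∀ C : EG →L[ℝ] E', HasMFDerivWithinAt 𝓘(ℝ, EG) 𝓘(ℝ, E') f {k | α k = α h} h C →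
      HasMFDerivAt 𝓘(ℝ, EG) 𝓘(ℝ, E') (fun k => f (r (α h, k))) h
        (C.comp (mfderiv 𝓘(ℝ, EG) 𝓘(ℝ, EG) (fun k => r (α h, k)) h)) := by
    intro C hC
    have hC' : ∀ y, y = h → HasMFDerivWithinAt 𝓘(ℝ, EG) 𝓘(ℝ, E') f {k | α k = α h} y C := by
      rintro _ rfl
      exact hC
    exact (HasMFDerivWithinAt.comp (f := fun k => r (α h, k)) h (hC' _ hrh)
      (hd.hasMFDerivAt.hasMFDerivWithinAt
        (s := (fun k => r (α h, k)) ⁻¹' {k | α k = α h})) subset_rfl).hasMFDerivAt hev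
  have h1 := DFunLike.congr_fun (hasMFDerivAt_unique (key A hA) (key A' hA')) v
  have hv' := hfix v hv
  exact (congrArg A hv').symm.trans (h1.trans (congrArg A' hv'))

end Retraction

/-- All tangent spaces unfold to the model space. Vectors over base points that agree only
propositionally can therefore be compared there, without transport. -/
theorem TangentBundle.mk_congr {E : Type*} [NormedAddCommGroup E] [NormedSpace ℝ E]
    {X : Type*} [TopologicalSpace X] [ChartedSpace E X] {x y : X}
    {v : TangentSpace 𝓘(ℝ, E) x} {w : TangentSpace 𝓘(ℝ, E) y} (h : x = y)
    (hv : @Eq E v w) :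
    (⟨x, v⟩ : TangentBundle 𝓘(ℝ, E) X) = ⟨y, w⟩ := by
  subst h
  exact congrArg _ hv

/-! ### Smooth extension of the product. -/

namespace SmoothQuasiloopoid

variable {EG : Type*} [NormedAddCommGroup EG] [NormedSpace ℝ EG]
  {G : Type*} [TopologicalSpace G] [ChartedSpace EG G]
  {EM : Type*} [NormedAddCommGroup EM] [NormedSpace ℝ EM]
  {M : Type*} [TopologicalSpace M] [ChartedSpace EM M]
  (Q : SmoothQuasiloopoid EG G EM M)

/-- The tangent map of the left translation `l_g` at `β g`, on normal vectors. -/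
def leftTranslate (g : G) : Q.NormalSpace (Q.source g) →ₗ[ℝ] TangentSpace 𝓘(ℝ, EG) g :=
  (mfderivWithin 𝓘(ℝ, EG) 𝓘(ℝ, EG) (Q.mul g) {h | Q.target h = Q.source g}
    (Q.unit (Q.source g))).toLinearMap ∘ₗ Q.leftRep (Q.source g)

variable [IsManifold 𝓘(ℝ, EG) ∞ G] [IsManifold 𝓘(ℝ, EM) ∞ M]

/-- The product extends, near a composable pair, to a smooth map on an open set, whose derivative
on vectors tangent to the `α`-fibres is that of the translations. -/
theorem exists_smooth_extension_mul (g₀ h₀ : G) (hgh : Q.source g₀ = Q.target h₀) :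
    ∃ (μ : G → G → G) (W : Set (G × G)), IsOpen W ∧ (g₀, h₀) ∈ W ∧
      ContMDiffOn (𝓘(ℝ, EG).prod 𝓘(ℝ, EG)) 𝓘(ℝ, EG) ∞ (Function.uncurry μ) W ∧
      ∀ g h, (g, h) ∈ W → Q.source g = Q.target h → μ g h = Q.mul g h ∧
        ∀ v : TangentSpace 𝓘(ℝ, EG) h, mfderiv 𝓘(ℝ, EG) 𝓘(ℝ, EM) Q.target h v = 0 →
          @Eq EG (mfderiv 𝓘(ℝ, EG) 𝓘(ℝ, EG) (μ g) h v)
            (mfderivWithin 𝓘(ℝ, EG) 𝓘(ℝ, EG) (Q.mul g) {k | Q.target k = Q.source g} h v) := by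
  obtain ⟨r, W, hWo, hW0, hr, hαr, hrα⟩ := Q.target_submersion.exists_fibre_retraction h₀
  have hβ := Q.source_submersion.contMDiff
  have hα := Q.target_submersion.contMDiff
  have hq : ContMDiff (𝓘(ℝ, EG).prod 𝓘(ℝ, EG)) (𝓘(ℝ, EM).prod 𝓘(ℝ, EG)) ∞
      (fun p : G × G => (Q.source p.1, p.2)) :=
    (hβ.comp contMDiff_fst).prodMk contMDiff_snd
  set W' : Set (G × G) := (fun p : G × G => (Q.source p.1, p.2)) ⁻¹' W with hW'
  have hrW : ContMDiffOn (𝓘(ℝ, EG).prod 𝓘(ℝ, EG)) 𝓘(ℝ, EG) ∞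
      (fun p : G × G => r (Q.source p.1, p.2)) W' :=
    hr.comp hq.contMDiffOn fun p hp => hp
  -- The second factor is first retracted onto the `α`-fibre over `β g`, so every product that
  -- occurs is defined.
  refine ⟨fun g h => Q.mul g (r (Q.source g, h)), W', hWo.preimage hq.continuous, ?_, ?_, ?_⟩
  · change (Q.source g₀, h₀) ∈ W
    rwa [hgh]
  · exact Q.contMDiffOn_mul.comp (contMDiffOn_fst.prodMk hrW) fun p hp => (hαr _ hp).symm
  · intro g h hgW hc
    have hW1 : (Q.target h, h) ∈ W := by rw [← hc]; exact hgW
    have hrh : r (Q.source g, h) = h := by rw [hc]; exact hrα h hW1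
    refine ⟨congrArg (Q.mul g) hrh, fun v hv => ?_⟩
    set A := mfderivWithin 𝓘(ℝ, EG) 𝓘(ℝ, EG) (Q.mul g) {k | Q.target k = Q.source g} h with hA
    have hmd : ContMDiffOn 𝓘(ℝ, EG) 𝓘(ℝ, EG) ∞ (Q.mul g) {k | Q.target k = Q.source g} :=
      Q.contMDiffOn_mul.comp (f := fun k => (g, k)) (contMDiffOn_const.prodMk contMDiffOn_id)
        fun k hk => Eq.symm hk
    have hAd : ∀ y, y = h → HasMFDerivWithinAt 𝓘(ℝ, EG) 𝓘(ℝ, EG) (Q.mul g)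
        {k | Q.target k = Q.source g} y A := by
      rintro _ rfl
      exact ((hmd _ hc.symm).mdifferentiableWithinAt (by simp)).hasMFDerivWithinAt
    obtain ⟨hslice, hfix⟩ := mfderiv_fibre_retraction hα hWo hr hrα hW1
    rw [← hc] at hslice hfix
    have hev' : ∀ᶠ k in 𝓝 h, r (Q.source g, k) ∈ {k | Q.target k = Q.source g} := by
      have : ∀ᶠ k in 𝓝 h, (Q.source g, k) ∈ W :=
        (continuous_const.prodMk continuous_id).continuousAt (hWo.mem_nhds hgW)
      exact this.mono fun k hk => hαr _ hk
    have hcomp := HasMFDerivWithinAt.comp (f := fun k => r (Q.source g, k)) h (hAd _ hrh)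
      (hslice.hasMFDerivAt.hasMFDerivWithinAt
        (s := (fun k => r (Q.source g, k)) ⁻¹' {k | Q.target k = Q.source g})) subset_rfl
    have := (hcomp.hasMFDerivAt hev').mfderiv
    refine (DFunLike.congr_fun this v).trans ?_
    exact congrArg A (hfix v hv)

end SmoothQuasiloopoid

/-! ### Smoothness of representatives and prolongations. -/

namespace SmoothQuasiloopoid

variable {EG : Type*} [NormedAddCommGroup EG] [NormedSpace ℝ EG] [FiniteDimensional ℝ EG]
  {G : Type*} [TopologicalSpace G] [ChartedSpace EG G] [IsManifold 𝓘(ℝ, EG) ∞ G]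
  {EM : Type*} [NormedAddCommGroup EM] [NormedSpace ℝ EM] [FiniteDimensional ℝ EM]
  {M : Type*} [TopologicalSpace M] [ChartedSpace EM M] [IsManifold 𝓘(ℝ, EM) ∞ M]
  (Q : SmoothQuasiloopoid EG G EM M)
  {E' : Type*} [NormedAddCommGroup E'] [NormedSpace ℝ E']
  {H' : Type*} [TopologicalSpace H'] {I' : ModelWithCorners ℝ E' H'}
  {P : Type*} [TopologicalSpace P] [ChartedSpace H' P] [IsManifold I' ∞ P]

theorem trivializationAt_normalSpace (a₀ : M) {a : M} (ha : a ∈ (Q.domPart a₀).source)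
    (X : Q.NormalSpace a) :
    (trivializationAt (NormalModel EG EM) Q.NormalSpace a₀ ⟨a, X⟩).2 = Q.normalEquiv a₀ a ha X :=
  congrArg Prod.snd (Q.normalPretrivialization_apply ha X)

theorem normalMk_normalLift {a₀ a : M} (ha : a ∈ (Q.domPart a₀).source) (X : Q.NormalSpace a) :
    Q.normalMk a (Q.normalLift a₀ a (Q.normalEquiv a₀ a ha X)) = X :=
  (Q.normalEquiv a₀ a ha).symm_apply_apply X

theorem leftRep_normalMk (a : M) (v : TangentSpace 𝓘(ℝ, EG) (Q.unit a)) :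
    Q.leftRep a (Q.normalMk a v) = v - mfderiv 𝓘(ℝ, EM) 𝓘(ℝ, EG) Q.unit a
      (mfderiv 𝓘(ℝ, EG) 𝓘(ℝ, EM) Q.target (Q.unit a) v) := rfl

theorem domPart_source_mem_nhds (a₀ : M) : (Q.domPart a₀).source ∈ 𝓝 a₀ :=
  (Q.domPart a₀).open_source.mem_nhds (Q.unit_immersionAt a₀).mem_domChart_source

omit [IsManifold I' ∞ P] in
theorem contMDiffAt_base_of_unit {a : P → M} {p₀ : P}
    (h : ContMDiffAt I' 𝓘(ℝ, EG) ∞ (fun p => Q.unit (a p)) p₀) :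
    ContMDiffAt I' 𝓘(ℝ, EM) ∞ a p₀ := by
  have h1 := (Q.target_submersion.contMDiff _).comp p₀ h
  exact h1.congr_of_eventuallyEq (Filter.Eventually.of_forall fun p => (Q.target_unit _).symm)

/-- The projection to the normal bundle is smooth. -/
theorem contMDiffAt_normalMk {a : P → M} {v : ∀ p, TangentSpace 𝓘(ℝ, EG) (Q.unit (a p))} {p₀ : P}
    (hv : ContMDiffAt I' 𝓘(ℝ, EG).tangent ∞
      (fun p => (⟨Q.unit (a p), v p⟩ : TangentBundle 𝓘(ℝ, EG) G)) p₀) :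
    ContMDiffAt I' (𝓘(ℝ, EM).prod 𝓘(ℝ, NormalModel EG EM)) ∞
      (fun p => (⟨a p, Q.normalMk (a p) (v p)⟩ :
        TotalSpace (NormalModel EG EM) Q.NormalSpace)) p₀ := by
  have ha := Q.contMDiffAt_base_of_unit (contMDiffAt_totalSpace.1 hv).1
  rw [contMDiffAt_totalSpace]
  refine ⟨ha, ?_⟩
  have hmem := Q.domPart_source_mem_nhds (a p₀)
  have hcod : ContMDiffAt 𝓘(ℝ, EG) 𝓘(ℝ, EG) ∞ (Q.codPart (a p₀)) (Q.unit (a p₀)) :=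
    contMDiffAt_of_mem_maximalAtlas (Q.unit_immersionAt (a p₀)).codChart_mem_maximalAtlas
      (Q.unit_mem_codPart (mem_of_mem_nhds hmem))
  have h1 := (contMDiffAt_tangentBundle_vectorSpace.1
    (ContMDiffAt.mfderiv_along (f := fun _ => Q.codPart (a p₀)) (m := fun p => Q.unit (a p))
      (hcod.comp (f := Prod.snd) (p₀, Q.unit (a p₀)) contMDiffAt_snd) hv)).2
  let L : EG →L[ℝ] NormalModel EG EM := (ContinuousLinearMap.snd ℝ EM (NormalModel EG EM)).comp
    ((Q.splitting (a p₀)).symm : EG →L[ℝ] EM × NormalModel EG EM)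
  refine (L.contMDiff.contMDiffAt.comp p₀ h1).congr_of_eventuallyEq ?_
  filter_upwards [ha.continuousAt.eventually hmem] with p hp
  exact Q.trivializationAt_normalSpace (a p₀) hp _

/-- A smooth normal vector has a smooth representative. -/
theorem exists_smooth_representative {a : P → M} {X : ∀ p, Q.NormalSpace (a p)} {p₀ : P}
    (hX : ContMDiffAt I' (𝓘(ℝ, EM).prod 𝓘(ℝ, NormalModel EG EM)) ∞
      (fun p => (⟨a p, X p⟩ : TotalSpace (NormalModel EG EM) Q.NormalSpace)) p₀) :
    ∃ v : ∀ p, TangentSpace 𝓘(ℝ, EG) (Q.unit (a p)),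
      ContMDiffAt I' 𝓘(ℝ, EG).tangent ∞
        (fun p => (⟨Q.unit (a p), v p⟩ : TangentBundle 𝓘(ℝ, EG) G)) p₀ ∧
      ∀ᶠ p in 𝓝 p₀, Q.normalMk (a p) (v p) = X p := by
  obtain ⟨ha, hc⟩ := contMDiffAt_totalSpace.1 hX
  have hmem := Q.domPart_source_mem_nhds (a p₀)
  have hu : ContMDiffAt I' 𝓘(ℝ, EG) ∞ (fun p => Q.unit (a p)) p₀ :=
    (Q.unit_embedding.contMDiff _).comp p₀ ha
  have hU := Q.unit_mem_codPart (mem_of_mem_nhds hmem)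
  have hcod : ContMDiffAt 𝓘(ℝ, EG) 𝓘(ℝ, EG) ∞ (Q.codPart (a p₀)) (Q.unit (a p₀)) :=
    contMDiffAt_of_mem_maximalAtlas (Q.unit_immersionAt (a p₀)).codChart_mem_maximalAtlas hU
  have hcod' : ContMDiffAt 𝓘(ℝ, EG) 𝓘(ℝ, EG) ∞ (Q.codPart (a p₀)).symm
      (Q.codPart (a p₀) (Q.unit (a p₀))) :=
    contMDiffAt_symm_of_mem_maximalAtlas (Q.unit_immersionAt (a p₀)).codChart_mem_maximalAtlas
      ((Q.codPart (a p₀)).map_source hU)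
  let w : P → NormalModel EG EM := fun p =>
    (trivializationAt (NormalModel EG EM) Q.NormalSpace (a p₀) ⟨a p, X p⟩).2
  let J : NormalModel EG EM →L[ℝ] EG :=
    (Q.splitting (a p₀) : EM × NormalModel EG EM →L[ℝ] EG).comp
      (ContinuousLinearMap.inr ℝ EM (NormalModel EG EM))
  have hJ : ContMDiffAt I' 𝓘(ℝ, EG).tangent ∞
      (fun p => (⟨Q.codPart (a p₀) (Q.unit (a p)), J (w p)⟩ : TangentBundle 𝓘(ℝ, EG) EG)) p₀ :=
    contMDiffAt_tangentBundle_vectorSpace.2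
      ⟨hcod.comp p₀ hu, J.contMDiff.contMDiffAt.comp p₀ hc⟩
  have h1 := ContMDiffAt.mfderiv_along (f := fun _ => (Q.codPart (a p₀)).symm)
    (m := fun p => Q.codPart (a p₀) (Q.unit (a p)))
    (hcod'.comp (f := Prod.snd) (p₀, _) contMDiffAt_snd) hJ
  have hev := ha.continuousAt.eventually hmem
  -- The representative has, in the slice chart at `a p₀`, tangential coordinate zero and normal
  -- coordinate given by the trivialisation of `X`.
  refine ⟨fun p => Q.normalLift (a p₀) (a p) (w p), h1.congr_of_eventuallyEq ?_, ?_⟩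
  · filter_upwards [hev] with p hp
    exact TangentBundle.mk_congr ((Q.codPart (a p₀)).left_inv (Q.unit_mem_codPart hp)).symm rfl
  · filter_upwards [hev] with p hp
    have := Q.trivializationAt_normalSpace (a p₀) hp (X p)
    change Q.normalMk (a p) (Q.normalLift (a p₀) (a p)
      (trivializationAt (NormalModel EG EM) Q.NormalSpace (a p₀) ⟨a p, X p⟩).2) = X p
    rw [this]
    exact Q.normalMk_normalLift hp (X p)

/-- Representatives tangent to the `α`-fibres depend smoothly on the normal vector. -/
theorem contMDiffAt_leftRep {a : P → M} {X : ∀ p, Q.NormalSpace (a p)} {p₀ : P}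
    (hX : ContMDiffAt I' (𝓘(ℝ, EM).prod 𝓘(ℝ, NormalModel EG EM)) ∞
      (fun p => (⟨a p, X p⟩ : TotalSpace (NormalModel EG EM) Q.NormalSpace)) p₀) :
    ContMDiffAt I' 𝓘(ℝ, EG).tangent ∞
      (fun p => (⟨Q.unit (a p), Q.leftRep (a p) (X p)⟩ : TangentBundle 𝓘(ℝ, EG) G)) p₀ := by
  obtain ⟨v, hv, hvX⟩ := Q.exists_smooth_representative hX
  have h1 := ContMDiffAt.mfderiv_along (f := fun _ => Q.target) (m := fun p => Q.unit (a p))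
    ((Q.target_submersion.contMDiff _).comp (f := Prod.snd) (p₀, _) contMDiffAt_snd) hv
  have h2 := ContMDiffAt.mfderiv_along (f := fun _ => Q.unit)
    (m := fun p => Q.target (Q.unit (a p)))
    ((Q.unit_embedding.contMDiff _).comp (f := Prod.snd) (p₀, _) contMDiffAt_snd) h1
  have h3 : ContMDiffAt I' 𝓘(ℝ, EG).tangent ∞
      (fun p => (⟨Q.unit (a p), mfderiv 𝓘(ℝ, EM) 𝓘(ℝ, EG) Q.unit (a p)
        (mfderiv 𝓘(ℝ, EG) 𝓘(ℝ, EM) Q.target (Q.unit (a p)) (v p))⟩ :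
          TangentBundle 𝓘(ℝ, EG) G)) p₀ := by
    refine h2.congr_of_eventuallyEq (Filter.Eventually.of_forall fun p => ?_)
    have : ∀ b (hb : b = a p) (y : EM), (⟨Q.unit (a p), mfderiv 𝓘(ℝ, EM) 𝓘(ℝ, EG) Q.unit (a p) y⟩ :
        TangentBundle 𝓘(ℝ, EG) G) = ⟨Q.unit b, mfderiv 𝓘(ℝ, EM) 𝓘(ℝ, EG) Q.unit b y⟩ := by
      rintro _ rfl y
      rfl
    exact this _ (Q.target_unit _) _
  refine (hv.sub_along (V := TangentSpace 𝓘(ℝ, EG)) (F := EG) h3).congr_of_eventuallyEq ?_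
  filter_upwards [hvX] with p hp
  rw [← hp, leftRep_normalMk]

/-- Left translation of normal vectors is smooth. -/
theorem contMDiffAt_leftTranslate {g : P → G} {X : ∀ p, Q.NormalSpace (Q.source (g p))} {p₀ : P}
    (hg : ContMDiffAt I' 𝓘(ℝ, EG) ∞ g p₀)
    (hX : ContMDiffAt I' (𝓘(ℝ, EM).prod 𝓘(ℝ, NormalModel EG EM)) ∞
      (fun p => (⟨Q.source (g p), X p⟩ : TotalSpace (NormalModel EG EM) Q.NormalSpace)) p₀) :
    ContMDiffAt I' 𝓘(ℝ, EG).tangent ∞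
      (fun p => (⟨g p, Q.leftTranslate (g p) (X p)⟩ : TangentBundle 𝓘(ℝ, EG) G)) p₀ := by
  have hc : ∀ g, Q.source g = Q.target (Q.unit (Q.source g)) := fun g => (Q.target_unit _).symm
  -- The translations have different fibres as domains, so their derivatives are replaced by those
  -- of `μ (g p)`, defined on open sets. The two agree on the representatives, which lie in `ker
  -- dα`.
  obtain ⟨μ, W, hW, hW0, hμ, hμW⟩ :=
    Q.exists_smooth_extension_mul (g p₀) (Q.unit (Q.source (g p₀))) (hc _)
  have hu : ContMDiffAt I' 𝓘(ℝ, EG) ∞ (fun p => Q.unit (Q.source (g p))) p₀ :=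
    (Q.unit_embedding.contMDiff _).comp p₀ ((Q.source_submersion.contMDiff _).comp p₀ hg)
  have hμ' : ContMDiffAt (I'.prod 𝓘(ℝ, EG)) 𝓘(ℝ, EG) ∞
      (Function.uncurry fun p h => μ (g p) h) (p₀, Q.unit (Q.source (g p₀))) :=
    (hμ.contMDiffAt (hW.mem_nhds hW0)).comp (f := fun q : P × G => (g q.1, q.2)) (p₀, _)
      ((hg.comp (f := Prod.fst) (p₀, Q.unit (Q.source (g p₀))) contMDiffAt_fst).prodMk
        contMDiffAt_snd)
  have h1 := ContMDiffAt.mfderiv_along (f := fun p h => μ (g p) h)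
    (m := fun p => Q.unit (Q.source (g p))) hμ' (Q.contMDiffAt_leftRep hX)
  refine h1.congr_of_eventuallyEq ?_
  filter_upwards [(hg.continuousAt.prodMk hu.continuousAt).eventually (hW.mem_nhds hW0)] with p hp
  obtain ⟨h2, h3⟩ := hμW _ _ hp (hc _)
  exact TangentBundle.mk_congr ((Q.mul_unit (g p)).symm.trans h2.symm)
    (h3 _ (Q.mfderiv_target_leftRep _ _)).symm

theorem hasMFDerivWithinAt_mul (g h : G) (hc : Q.source g = Q.target h) :
    HasMFDerivWithinAt 𝓘(ℝ, EG) 𝓘(ℝ, EG) (Q.mul g) {k | Q.target k = Q.source g} h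
      (mfderivWithin 𝓘(ℝ, EG) 𝓘(ℝ, EG) (Q.mul g) {k | Q.target k = Q.source g} h) := by
  have hmd : ContMDiffOn 𝓘(ℝ, EG) 𝓘(ℝ, EG) ∞ (Q.mul g) {k | Q.target k = Q.source g} :=
    Q.contMDiffOn_mul.comp (f := fun k => (g, k)) (contMDiffOn_const.prodMk contMDiffOn_id)
      fun k hk => Eq.symm hk
  exact ((hmd _ hc.symm).mdifferentiableWithinAt (by simp)).hasMFDerivWithinAt

/-- By the unit law, translation by a unit is the identity on its `α`-fibre, so its derivative
within the fibre is the identity on `ker dα`. -/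
theorem leftProlongation_unit (X : ∀ a, Q.NormalSpace a) (a : M) :
    Q.leftProlongation X (Q.unit a) = Q.leftRep a (X a) := by
  have key : ∀ b (hb : b = a), @Eq EG (mfderivWithin 𝓘(ℝ, EG) 𝓘(ℝ, EG) (Q.mul (Q.unit a))
      {h | Q.target h = b} (Q.unit b) (Q.leftRep b (X b))) (Q.leftRep a (X a)) := by
    rintro _ rfl
    rename_i b
    have h1 := Q.hasMFDerivWithinAt_mul (Q.unit b) (Q.unit b) (by
      rw [Q.source_unit, Q.target_unit])
    rw [Q.source_unit] at h1
    have e : ∀ k, Q.target k = b → Q.mul (Q.unit b) k = k := by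
      rintro k rfl
      exact Q.unit_mul k
    have hu : Q.mul (Q.unit b) (Q.unit b) = Q.unit b := e _ (Q.target_unit b)
    have h2 : HasMFDerivWithinAt 𝓘(ℝ, EG) 𝓘(ℝ, EG) (Q.mul (Q.unit b)) {k | Q.target k = b}
        (Q.unit b) (ContinuousLinearMap.id ℝ EG : EG →L[ℝ] EG) :=
      (hasMFDerivAt_id (Q.unit b)).hasMFDerivWithinAt.congr_mono e hu (subset_univ _)
    exact Q.target_submersion.hasMFDerivWithinAt_fibre_unique h1 h2 (Q.target_unit b)
      (Q.mfderiv_target_leftRep b (X b))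
  exact key _ (Q.source_unit a)

/-- The left prolongation of a smooth section is a smooth vector field. -/
theorem contMDiff_leftProlongation {X : ∀ a, Q.NormalSpace a}
    (hX : IsSmoothSection 𝓘(ℝ, EM) (NormalModel EG EM) X) :
    ContMDiff 𝓘(ℝ, EG) 𝓘(ℝ, EG).tangent ∞
      (fun g => (⟨g, Q.leftProlongation X g⟩ : TangentBundle 𝓘(ℝ, EG) G)) := fun g =>
  Q.contMDiffAt_leftTranslate (X := fun g => X (Q.source g)) contMDiffAt_id
    ((hX _).comp g (Q.source_submersion.contMDiff g))

end SmoothQuasiloopoid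

/-! ### The left and right skew algebroids. -/

namespace SmoothQuasiloopoid

variable {EG : Type*} [NormedAddCommGroup EG] [NormedSpace ℝ EG] [FiniteDimensional ℝ EG]
  {G : Type*} [TopologicalSpace G] [ChartedSpace EG G] [IsManifold 𝓘(ℝ, EG) ∞ G]
  {EM : Type*} [NormedAddCommGroup EM] [NormedSpace ℝ EM] [FiniteDimensional ℝ EM]
  {M : Type*} [TopologicalSpace M] [ChartedSpace EM M] [IsManifold 𝓘(ℝ, EM) ∞ M]
  (Q : SmoothQuasiloopoid EG G EM M)

theorem leftProlongation_add (X Y : ∀ a, Q.NormalSpace a) :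
    Q.leftProlongation (fun a => X a + Y a) = Q.leftProlongation X + Q.leftProlongation Y :=
  funext fun g => map_add (Q.leftTranslate g) _ _

/-- The prolongation at `g` is linear in the single value of the section at `β g`. This is the
source of the anchor `Tβ` in the Leibniz rule. -/
theorem leftProlongation_smul (f : M → ℝ) (X : ∀ a, Q.NormalSpace a) :
    Q.leftProlongation (fun a => f a • X a) = (f ∘ Q.source) • Q.leftProlongation X :=
  funext fun g => map_smul (Q.leftTranslate g) _ _

theorem contMDiff_leftAlgebroid_anchor :
    ContMDiff (𝓘(ℝ, EM).prod 𝓘(ℝ, NormalModel EG EM)) (𝓘(ℝ, EM).prod 𝓘(ℝ, EM)) ∞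
      fun e : TotalSpace (NormalModel EG EM) Q.NormalSpace =>
        (⟨e.1, Q.leftAlgebroid.anchor e.1 e.2⟩ : TangentBundle 𝓘(ℝ, EM) M) := by
  intro e₀
  have h1 := Q.contMDiffAt_leftRep (I' := 𝓘(ℝ, EM).prod 𝓘(ℝ, NormalModel EG EM))
    (P := TotalSpace (NormalModel EG EM) Q.NormalSpace) (a := fun e => e.1) (X := fun e => e.2)
    (p₀ := e₀) contMDiffAt_id
  have h2 := ContMDiffAt.mfderiv_along (f := fun _ => Q.source)
    (m := fun e : TotalSpace (NormalModel EG EM) Q.NormalSpace => Q.unit e.1)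
    ((Q.source_submersion.contMDiff _).comp (f := Prod.snd) (e₀, _) contMDiffAt_snd) h1
  exact h2.congr_of_eventuallyEq (Filter.Eventually.of_forall fun e =>
    TangentBundle.mk_congr (Q.source_unit e.1).symm rfl)

/-- The left structure `A^l G` is a skew algebroid. -/
theorem isSkewAlgebroid_left : IsSkewAlgebroid (NormalModel EG EM) Q.leftAlgebroid where
  contMDiff_anchor := Q.contMDiff_leftAlgebroid_anchor
  smooth_bracket X Y hX hY a := by
    have : IsManifold 𝓘(ℝ, EG) (minSmoothness ℝ 2) G := by
      rw [minSmoothness_of_isRCLikeNormedField]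
      exact IsManifold.of_le (n := ∞) ENat.LEInfty.out
    have : IsManifold 𝓘(ℝ, EG) (((⊤ : ℕ∞) : WithTop ℕ∞) + 1) G :=
      IsManifold.of_le (n := ∞) (by simp)
    have h := ContMDiffAt.mlieBracket_vectorField (I := 𝓘(ℝ, EG)) (m := ⊤) (n := ⊤)
      (Q.contMDiff_leftProlongation hX (Q.unit a)) (Q.contMDiff_leftProlongation hY (Q.unit a))
      (by simp)
    exact Q.contMDiffAt_normalMk (h.comp a (Q.unit_embedding.contMDiff a))
  skew X Y _ _ a := by
    have h := mlieBracket_swap_apply (I := 𝓘(ℝ, EG)) (V := Q.leftProlongation X)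
      (W := Q.leftProlongation Y) (x := Q.unit a)
    change Q.normalMk a _ + Q.normalMk a _ = 0
    rw [h, map_neg, neg_add_cancel]
  bracket_add X Y Z _ hY hZ a := by
    have : IsManifold 𝓘(ℝ, EG) 2 G := IsManifold.of_le (n := ∞) ENat.LEInfty.out
    have h := mlieBracket_add_right (I := 𝓘(ℝ, EG)) (V := Q.leftProlongation X)
      ((Q.contMDiff_leftProlongation hY (Q.unit a)).mdifferentiableAt (by simp))
      ((Q.contMDiff_leftProlongation hZ (Q.unit a)).mdifferentiableAt (by simp))
    change Q.normalMk a (mlieBracket _ _ (Q.leftProlongation _) _) = Q.normalMk a _ + Q.normalMk a _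
    rw [leftProlongation_add, h, map_add]
  bracket_smul X Y _ hY c a := by
    have : IsManifold 𝓘(ℝ, EG) 2 G := IsManifold.of_le (n := ∞) ENat.LEInfty.out
    have h := mlieBracket_const_smul_right (I := 𝓘(ℝ, EG)) (V := Q.leftProlongation X) (c := c)
      ((Q.contMDiff_leftProlongation hY (Q.unit a)).mdifferentiableAt (by simp))
    change Q.normalMk a (mlieBracket _ _ (Q.leftProlongation _) _) = c • Q.normalMk a _
    rw [Q.leftProlongation_smul (fun _ => c)]
    exact (congrArg _ h).trans (map_smul _ _ _)
  leibniz X Y _ hY f hf a := by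
    have : IsManifold 𝓘(ℝ, EG) 2 G := IsManifold.of_le (n := ∞) ENat.LEInfty.out
    have hs := (Q.source_submersion.contMDiff (Q.unit a)).mdifferentiableAt (by simp)
    have hfd := (hf (Q.source (Q.unit a))).mdifferentiableAt (by simp)
    have h := mlieBracket_smul_right (I := 𝓘(ℝ, EG)) (V := Q.leftProlongation X)
      (hfd.comp (Q.unit a) hs)
      ((Q.contMDiff_leftProlongation hY (Q.unit a)).mdifferentiableAt (by simp))
    change Q.normalMk a (mlieBracket _ _ (Q.leftProlongation _) _) =
      _ • Y a + f a • Q.normalMk a _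
    -- At the unit, both prolongations become representatives. Projection returns `Y a`, and the
    -- derivative of `f ∘ β` along the representative of `X a` is `df` applied to the anchor.
    rw [leftProlongation_smul, h, map_add, map_smul, map_smul, Q.leftProlongation_unit Y,
      normalMk_leftRep, Q.leftProlongation_unit X, mvfderiv_comp_apply _ hfd hs]
    have key : ∀ b (hb : b = a) (w : EM), mvfderiv 𝓘(ℝ, EM) f b w • Y a +
        f b • Q.normalMk a (mlieBracket 𝓘(ℝ, EG) (Q.leftProlongation X) (Q.leftProlongation Y)
          (Q.unit a)) = directionalDeriv 𝓘(ℝ, EM) f a w • Y a +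
        f a • Q.normalMk a (mlieBracket 𝓘(ℝ, EG) (Q.leftProlongation X) (Q.leftProlongation Y)
          (Q.unit a)) := by
      rintro _ rfl w
      rfl
    exact key _ (Q.source_unit a) _

/-- The two anchors are opposite to each other. -/
theorem rightAlgebroid_anchor (a : M) (X : Q.NormalSpace a) :
    Q.rightAlgebroid.anchor a X = -Q.leftAlgebroid.anchor a X := by
  obtain ⟨v, rfl⟩ := Submodule.Quotient.mk_surjective _ X
  -- Since the unit map is a section of `α` and of `β`, the right anchor of `[v]` is `dα v - dβ v`
  -- and the left anchor is `dβ v - dα v`.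
  have h1 := (map_sub (mfderiv 𝓘(ℝ, EG) 𝓘(ℝ, EM) Q.target (Q.unit a)) v
    (mfderiv 𝓘(ℝ, EM) 𝓘(ℝ, EG) Q.unit a (mfderiv 𝓘(ℝ, EG) 𝓘(ℝ, EM) Q.source (Q.unit a) v))).trans
    (congrArg _ (Q.mfderiv_target_unit a _))
  have h2 := (map_sub (mfderiv 𝓘(ℝ, EG) 𝓘(ℝ, EM) Q.source (Q.unit a)) v
    (mfderiv 𝓘(ℝ, EM) 𝓘(ℝ, EG) Q.unit a (mfderiv 𝓘(ℝ, EG) 𝓘(ℝ, EM) Q.target (Q.unit a) v))).trans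
    (congrArg _ (Q.mfderiv_source_unit a _))
  exact h1.trans ((neg_sub (α := EM) _ _).symm.trans (congrArg (fun t : EM => -t) h2.symm))

/-- The opposite quasiloopoid. -/
def op : SmoothQuasiloopoid EG G EM M where
  target := Q.source
  source := Q.target
  unit := Q.unit
  mul g h := Q.mul h g
  target_submersion := Q.source_submersion
  source_submersion := Q.target_submersion
  unit_embedding := Q.unit_embedding
  target_unit := Q.source_unit
  source_unit := Q.target_unit
  contMDiffOn_mul := Q.contMDiffOn_mul.comp (contMDiffOn_snd.prodMk contMDiffOn_fst)
    fun _ hp => Eq.symm hp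
  mul_unit := Q.unit_mul
  unit_mul := Q.mul_unit
  left_injOn := Q.right_injOn
  right_injOn := Q.left_injOn
  left_immersion g h := Q.right_immersion h g
  right_immersion g h := Q.left_immersion h g

/-- The normal bundle depends only on the unit embedding, which passing to the opposite does not
change. The right structure therefore unfolds to the left structure of `Q.op`. -/
theorem isSkewAlgebroid_right : IsSkewAlgebroid (NormalModel EG EM) Q.rightAlgebroid :=
  Q.op.isSkewAlgebroid_left

end SmoothQuasiloopoid

/-! ### The graph of a smooth map as a submanifold. -/

section Graph

variable {EN : Type*} [NormedAddCommGroup EN] [NormedSpace ℝ EN]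
  {N : Type*} [TopologicalSpace N] [ChartedSpace EN N] [IsManifold 𝓘(ℝ, EN) ∞ N]
  {EM : Type*} [NormedAddCommGroup EM] [NormedSpace ℝ EM]
  {M : Type*} [TopologicalSpace M] [ChartedSpace EM M] [IsManifold 𝓘(ℝ, EM) ∞ M]

/-- The partial homeomorphism `(x, y) ↦ (φ x, ψ y - ψ (f x))` straightening the graph of `f`. -/
def graphChart {f : N → M} (hf : Continuous f) (φ : OpenPartialHomeomorph N EN)
    (ψ : OpenPartialHomeomorph M EM) : OpenPartialHomeomorph (N × M) (ModelProd EN EM) where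
  toFun q := (φ q.1, ψ q.2 - ψ (f q.1))
  invFun u := (φ.symm u.1, ψ.symm (u.2 + ψ (f (φ.symm u.1))))
  source := (φ.source ∩ f ⁻¹' ψ.source) ×ˢ ψ.source
  target := ((φ.target ∩ φ.symm ⁻¹' (f ⁻¹' ψ.source)) ×ˢ univ) ∩
    (fun u : EN × EM => u.2 + ψ (f (φ.symm u.1))) ⁻¹' ψ.target
  map_source' := by
    rintro ⟨x, y⟩ ⟨⟨hx, hfx⟩, hy⟩
    have hx' : φ.symm (φ x) = x := φ.left_inv hx
    refine ⟨⟨⟨φ.map_source hx, ?_⟩, mem_univ _⟩, ?_⟩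
    · rwa [mem_preimage, hx']
    · simpa [hx'] using ψ.map_source hy
  map_target' := by
    rintro ⟨u, w⟩ ⟨⟨⟨hu, hfu⟩, -⟩, hw⟩
    exact ⟨⟨φ.map_target hu, hfu⟩, ψ.map_target hw⟩
  left_inv' := by
    rintro ⟨x, y⟩ ⟨⟨hx, hfx⟩, hy⟩
    simp_all
  right_inv' := by
    rintro ⟨u, w⟩ ⟨⟨⟨hu, hfu⟩, -⟩, hw⟩
    have hw' : w + ψ (f (φ.symm u)) ∈ ψ.target := hw
    simp_all
  open_source := (φ.open_source.inter (ψ.open_source.preimage hf)).prod ψ.open_source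
  open_target := by
    have ho : IsOpen (φ.target ∩ φ.symm ⁻¹' (f ⁻¹' ψ.source)) :=
      φ.continuousOn_symm.isOpen_inter_preimage φ.open_target (ψ.open_source.preimage hf)
    refine ContinuousOn.isOpen_inter_preimage ?_ (ho.prod isOpen_univ) ψ.open_target
    refine continuousOn_snd.add (ψ.continuousOn.comp
      (hf.comp_continuousOn (φ.continuousOn_symm.comp continuousOn_fst ?_)) ?_)
    · exact fun u hu => hu.1.1
    · exact fun u hu => hu.1.2
  continuousOn_toFun := by
    refine (φ.continuousOn.comp continuousOn_fst fun q hq => hq.1.1).prodMk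
      ((ψ.continuousOn.comp continuousOn_snd fun q hq => hq.2).sub
        (ψ.continuousOn.comp (hf.comp_continuousOn continuousOn_fst) fun q hq => hq.1.2))
  continuousOn_invFun := by
    refine (φ.continuousOn_symm.comp continuousOn_fst fun u hu => hu.1.1.1).prodMk
      (ψ.continuousOn_symm.comp (continuousOn_snd.add (ψ.continuousOn.comp
      (hf.comp_continuousOn (φ.continuousOn_symm.comp continuousOn_fst ?_)) ?_)) ?_)
    · exact fun u hu => hu.1.1.1
    · exact fun u hu => hu.1.1.2
    · exact fun u hu => hu.2

theorem graphChart_mem_maximalAtlas {f : N → M} (hf : ContMDiff 𝓘(ℝ, EN) 𝓘(ℝ, EM) ∞ f)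
    {φ : OpenPartialHomeomorph N EN} (hφ : φ ∈ IsManifold.maximalAtlas 𝓘(ℝ, EN) ∞ N)
    {ψ : OpenPartialHomeomorph M EM} (hψ : ψ ∈ IsManifold.maximalAtlas 𝓘(ℝ, EM) ∞ M) :
    graphChart hf.continuous φ ψ ∈
      IsManifold.maximalAtlas (𝓘(ℝ, EN).prod 𝓘(ℝ, EM)) ∞ (N × M) := by
  have h1 := contMDiffOn_of_mem_maximalAtlas hφ
  have h2 := contMDiffOn_symm_of_mem_maximalAtlas hφ
  have h3 := contMDiffOn_of_mem_maximalAtlas hψ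
  have h4 := contMDiffOn_symm_of_mem_maximalAtlas hψ
  refine OpenPartialHomeomorph.mem_maximalAtlas_of_contMDiffOn _ ?_ ?_
  · have h5 := h3.comp (f := Prod.snd) (s := (graphChart hf.continuous φ ψ).source)
      (contMDiffOn_snd (I := 𝓘(ℝ, EN)) (M := N)) fun q hq => hq.2
    have h6 := h3.comp (f := fun q : N × M => f q.1) (s := (graphChart hf.continuous φ ψ).source)
      (hf.comp_contMDiffOn (contMDiffOn_fst (J := 𝓘(ℝ, EM)) (N := M))) (fun q hq => hq.1.2)
    have h7 := (h1.comp (f := Prod.fst) contMDiffOn_fst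
      (fun q hq => hq.1.1)).prodMk (h5.sub h6)
    -- The product of the two model charted spaces is identified with the self-model of the product
    -- space.
    rw [chartedSpaceSelf_prod] at h7
    exact h7
  · have h5 := h2.comp (f := Prod.fst) (s := (graphChart hf.continuous φ ψ).target)
      (contMDiffOn_fst (J := 𝓘(ℝ, EM)) (N := EM)) fun q hq => hq.1.1.1
    have h6 := h3.comp (f := fun u : EN × EM => f (φ.symm u.1)) (hf.comp_contMDiffOn h5)
      (fun q hq => hq.1.1.2)
    have h7 := h5.prodMk (h4.comp (contMDiffOn_snd.add h6) fun u hu => hu.2)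
    rw [chartedSpaceSelf_prod] at h7
    exact h7

/-- The graph of a smooth map is a submanifold. -/
theorem ContMDiff.isSmoothEmbedding_graph {f : N → M} (hf : ContMDiff 𝓘(ℝ, EN) 𝓘(ℝ, EM) ∞ f) :
    IsSmoothEmbedding 𝓘(ℝ, EN) (𝓘(ℝ, EN).prod 𝓘(ℝ, EM)) ∞ fun x => (x, f x) := by
  refine ⟨IsImmersionOfComplement.isImmersion (F := EM) fun x => ?_,
    isEmbedding_graph hf.continuous⟩
  have hφ := IsManifold.chart_mem_maximalAtlas (I := 𝓘(ℝ, EN)) (n := ∞) x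
  have hψ := IsManifold.chart_mem_maximalAtlas (I := 𝓘(ℝ, EM)) (n := ∞) (f x)
  refine IsImmersionAtOfComplement.mk_of_continuousAt
    (continuous_id.prodMk hf.continuous).continuousAt (ContinuousLinearEquiv.refl ℝ (EN × EM))
    (chartAt EN x) (graphChart hf.continuous (chartAt EN x) (chartAt EM (f x)))
    (mem_chart_source EN x) ⟨⟨mem_chart_source EN x, mem_chart_source EM (f x)⟩,
      mem_chart_source EM (f x)⟩ hφ (graphChart_mem_maximalAtlas hf hφ hψ) ?_
  -- On the graph the second coordinate `ψ y - ψ (f x)` vanishes, so the map reads `u ↦ (u, 0)`, the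
  -- normal form of an immersion with complement `EM`.
  intro u hu
  have hu' : u ∈ (chartAt EN x).target := by simpa using hu
  simp [graphChart, hu']

end Graph

/-! ### Smooth sections of an external product. -/

section ExternalProduct

variable {E₁ : Type*} [NormedAddCommGroup E₁] [NormedSpace ℝ E₁]
  {H₁ : Type*} [TopologicalSpace H₁] {I₁ : ModelWithCorners ℝ E₁ H₁}
  {M₁ : Type*} [TopologicalSpace M₁] [ChartedSpace H₁ M₁]
  {F₁ : Type*} [NormedAddCommGroup F₁] [NormedSpace ℝ F₁] {V₁ : M₁ → Type*}
  [TopologicalSpace (TotalSpace F₁ V₁)] [∀ x, TopologicalSpace (V₁ x)] [∀ x, AddCommGroup (V₁ x)]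
  [∀ x, Module ℝ (V₁ x)] [FiberBundle F₁ V₁] [VectorBundle ℝ F₁ V₁]
  {E₂ : Type*} [NormedAddCommGroup E₂] [NormedSpace ℝ E₂]
  {H₂ : Type*} [TopologicalSpace H₂] {I₂ : ModelWithCorners ℝ E₂ H₂}
  {M₂ : Type*} [TopologicalSpace M₂] [ChartedSpace H₂ M₂]
  {F₂ : Type*} [NormedAddCommGroup F₂] [NormedSpace ℝ F₂] {V₂ : M₂ → Type*}
  [TopologicalSpace (TotalSpace F₂ V₂)] [∀ x, TopologicalSpace (V₂ x)] [∀ x, AddCommGroup (V₂ x)]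
  [∀ x, Module ℝ (V₂ x)] [FiberBundle F₂ V₂] [VectorBundle ℝ F₂ V₂]
  {E' : Type*} [NormedAddCommGroup E'] [NormedSpace ℝ E']
  {H' : Type*} [TopologicalSpace H'] {I' : ModelWithCorners ℝ E' H'}
  {P : Type*} [TopologicalSpace P] [ChartedSpace H' P]

/-- A map to the total space of an external product is smooth iff both components are. -/
theorem contMDiffWithinAt_externalProduct {q : P → M₁ × M₂}
    {s : ∀ p, ExternalProduct I₁ V₁ I₂ V₂ (q p)} {S : Set P} {p₀ : P} :
    ContMDiffWithinAt I' ((I₁.prod I₂).prod 𝓘(ℝ, F₁ × F₂)) ∞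
      (fun p => (⟨q p, s p⟩ : TotalSpace (F₁ × F₂) (ExternalProduct I₁ V₁ I₂ V₂))) S p₀ ↔
    ContMDiffWithinAt I' (I₁.prod 𝓘(ℝ, F₁)) ∞
      (fun p => (⟨(q p).1, (s p).1⟩ : TotalSpace F₁ V₁)) S p₀ ∧
    ContMDiffWithinAt I' (I₂.prod 𝓘(ℝ, F₂)) ∞
      (fun p => (⟨(q p).2, (s p).2⟩ : TotalSpace F₂ V₂)) S p₀ := by
  rw [contMDiffWithinAt_totalSpace, contMDiffWithinAt_totalSpace, contMDiffWithinAt_totalSpace,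
    contMDiffWithinAt_prod_iff, contMDiffWithinAt_prod_module_iff]
  constructor
  · rintro ⟨⟨h1, h2⟩, h3, h4⟩
    exact ⟨⟨h1, h3⟩, h2, h4⟩
  · rintro ⟨⟨h1, h3⟩, h2, h4⟩
    exact ⟨⟨h1, h2⟩, h3, h4⟩

end ExternalProduct

/-! ### Derivatives of maps into a fixed fibre. -/

section FibreDeriv

variable {EM : Type*} [NormedAddCommGroup EM] [NormedSpace ℝ EM]
  {HM : Type*} [TopologicalSpace HM] {I : ModelWithCorners ℝ EM HM}
  {M : Type*} [TopologicalSpace M] [ChartedSpace HM M]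
  {F : Type*} [NormedAddCommGroup F] [NormedSpace ℝ F] {V : M → Type*}
  [TopologicalSpace (TotalSpace F V)] [∀ x, TopologicalSpace (V x)] [∀ x, AddCommGroup (V x)]
  [∀ x, Module ℝ (V x)] [FiberBundle F V] [VectorBundle ℝ F V]
  {EN : Type*} [NormedAddCommGroup EN] [NormedSpace ℝ EN]
  {N : Type*} [TopologicalSpace N] [ChartedSpace EN N]
  {EP : Type*} [NormedAddCommGroup EP] [NormedSpace ℝ EP]
  {P : Type*} [TopologicalSpace P] [ChartedSpace EP P]

/-- The fibre at `x` identified with the model fibre. -/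
abbrev fibreEquivAt (x : M) : V x ≃L[ℝ] F :=
  (trivializationAt F V x).continuousLinearEquivAt ℝ x (FiberBundle.mem_baseSet_trivializationAt' x)

theorem mdifferentiableAt_fibreEquivAt {x : M} {s : N → V x} {n : N}
    (hs : ContMDiffAt 𝓘(ℝ, EN) (I.prod 𝓘(ℝ, F)) ∞
      (fun n => (⟨x, s n⟩ : TotalSpace F V)) n) :
    MDifferentiableAt 𝓘(ℝ, EN) 𝓘(ℝ, F) (fun n => fibreEquivAt (F := F) (V := V) x (s n)) n := by
  refine ((contMDiffAt_totalSpace.1 hs).2.mdifferentiableAt (by simp)).congr_of_eventuallyEq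
    (Filter.Eventually.of_forall fun m => ?_)
  rfl

/-- Once the fibre is identified with its finite-dimensional model, `A` becomes a continuous linear
map and so commutes with differentiation. -/
theorem mvfderiv_linear_comp [FiniteDimensional ℝ F] {x : M} {s : N → V x} {n : N}
    (hs : ContMDiffAt 𝓘(ℝ, EN) (I.prod 𝓘(ℝ, F)) ∞
      (fun n => (⟨x, s n⟩ : TotalSpace F V)) n)
    {E' : Type*} [NormedAddCommGroup E'] [NormedSpace ℝ E'] (A : V x →ₗ[ℝ] E')
    (w : TangentSpace 𝓘(ℝ, EN) n) :
    mvfderiv 𝓘(ℝ, EN) (fun n => A (s n)) n w = A (fibreDeriv F V 𝓘(ℝ, EN) x s n w) := by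
  let L : V x ≃L[ℝ] F := fibreEquivAt (F := F) (V := V) x
  let C : F →L[ℝ] E' := LinearMap.toContinuousLinearMap (A ∘ₗ (L.symm : F →L[ℝ] V x).toLinearMap)
  have h := mvfderiv_clm_comp C (mdifferentiableAt_fibreEquivAt hs) w
  have e : (fun n => A (s n)) = fun n => C (L (s n)) := by
    funext n
    exact congrArg A (L.symm_apply_apply (s n)).symm
  rw [e]
  exact h

/-- The chain rule in a fixed fibre. On a graph it converts a derivative along the source base into
one along the target base. -/
theorem fibreDeriv_comp {x : M} {s : N → V x} {f : P → N} {p : P}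
    (hs : ContMDiffAt 𝓘(ℝ, EN) (I.prod 𝓘(ℝ, F)) ∞
      (fun n => (⟨x, s n⟩ : TotalSpace F V)) (f p))
    (hf : MDifferentiableAt 𝓘(ℝ, EP) 𝓘(ℝ, EN) f p) (w : TangentSpace 𝓘(ℝ, EP) p) :
    fibreDeriv F V 𝓘(ℝ, EP) x (fun p => s (f p)) p w =
      fibreDeriv F V 𝓘(ℝ, EN) x s (f p) (mfderiv 𝓘(ℝ, EP) 𝓘(ℝ, EN) f p w) := by
  have h := ((mdifferentiableAt_fibreEquivAt hs).hasMFDerivAt.comp p hf.hasMFDerivAt).mfderiv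
  exact congrArg (fibreEquivAt (F := F) (V := V) x).symm (DFunLike.congr_fun h w)

end FibreDeriv

/-! ### Anchors and prolongations under a morphism. -/

namespace SmoothQuasiloopoid

variable {EB : Type*} [NormedAddCommGroup EB] [NormedSpace ℝ EB] [FiniteDimensional ℝ EB]
  {B : Type*} [TopologicalSpace B] [ChartedSpace EB B] [IsManifold 𝓘(ℝ, EB) ∞ B]
  {EN : Type*} [NormedAddCommGroup EN] [NormedSpace ℝ EN] [FiniteDimensional ℝ EN]
  {N : Type*} [TopologicalSpace N] [ChartedSpace EN N] [IsManifold 𝓘(ℝ, EN) ∞ N]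
  {EG : Type*} [NormedAddCommGroup EG] [NormedSpace ℝ EG] [FiniteDimensional ℝ EG]
  {G : Type*} [TopologicalSpace G] [ChartedSpace EG G] [IsManifold 𝓘(ℝ, EG) ∞ G]
  {EM : Type*} [NormedAddCommGroup EM] [NormedSpace ℝ EM] [FiniteDimensional ℝ EM]
  {M : Type*} [TopologicalSpace M] [ChartedSpace EM M] [IsManifold 𝓘(ℝ, EM) ∞ M]

/-- `φ` over `f` is the map of normal bundles induced by `F`. -/
structure InducesNormalMap (Q : SmoothQuasiloopoid EB B EN N) (R : SmoothQuasiloopoid EG G EM M)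
    (F : B → G) (f : N → M) (φ : ∀ a, Q.NormalSpace a →ₗ[ℝ] R.NormalSpace (f a)) : Prop where
  map_unit : ∀ a, F (Q.unit a) = R.unit (f a)
  map_normalMk : ∀ a (v : EB),
    φ a (Q.normalMk a v) = R.normalMk (f a) (mfderiv 𝓘(ℝ, EB) 𝓘(ℝ, EG) F (Q.unit a) v)

namespace IsMorphism

variable {Q : SmoothQuasiloopoid EB B EN N} {R : SmoothQuasiloopoid EG G EM M} {F : B → G}
  {f : N → M} {φ : ∀ a, Q.NormalSpace a →ₗ[ℝ] R.NormalSpace (f a)}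

/-- The product of `x` with the unit at `β x` is defined, hence so is the product of their images,
and the second image is the unit at `f (β x)`. -/
theorem base_source (hF : Q.IsMorphism R F) (hφ : InducesNormalMap Q R F f φ) (x : B) :
    R.source (F x) = f (Q.source x) := by
  rw [hF.composable x (Q.unit (Q.source x)) (Q.target_unit _).symm, hφ.map_unit, R.target_unit]

theorem base_target (hF : Q.IsMorphism R F) (hφ : InducesNormalMap Q R F f φ) (x : B) :
    R.target (F x) = f (Q.target x) := by
  rw [← hF.composable (Q.unit (Q.target x)) x (Q.source_unit _), hφ.map_unit, R.source_unit]

theorem contMDiff_base (hF : Q.IsMorphism R F) (hφ : InducesNormalMap Q R F f φ) :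
    ContMDiff 𝓘(ℝ, EN) 𝓘(ℝ, EM) ∞ f := by
  have h := R.target_submersion.contMDiff.comp (hF.contMDiff.comp Q.unit_embedding.contMDiff)
  have e : R.target ∘ F ∘ Q.unit = f := funext fun a => by
    simp [hφ.map_unit, R.target_unit]
  rwa [e] at h

/-- Since `α ∘ F = f ∘ α`, the differential of `F` preserves `ker dα`. The image of the
representative is thus annihilated by `dα`, and the correction term in `leftRep` of its class
vanishes. -/
theorem mfderiv_leftRep (hF : Q.IsMorphism R F) (hφ : InducesNormalMap Q R F f φ) (a : N)
    (X : Q.NormalSpace a) :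
    @Eq EG (mfderiv 𝓘(ℝ, EB) 𝓘(ℝ, EG) F (Q.unit a) (Q.leftRep a X)) (R.leftRep (f a) (φ a X)) := by
  set v : EB := Q.leftRep a X with hv
  have h1 : φ a X = R.normalMk (f a) (mfderiv 𝓘(ℝ, EB) 𝓘(ℝ, EG) F (Q.unit a) v) := by
    rw [← hφ.map_normalMk]
    exact congrArg (φ a) (Q.normalMk_leftRep a X).symm
  have hFd := ((hF.contMDiff (Q.unit a)).mdifferentiableAt (by simp)).hasMFDerivAt
  -- The points `F (Q.unit a)` and `R.unit (f a)` agree only propositionally; this lets the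
  -- derivative of `R.target` be written at either one.
  have hRd : ∀ y, y = F (Q.unit a) → HasMFDerivAt 𝓘(ℝ, EG) 𝓘(ℝ, EM) R.target (F (Q.unit a))
      (mfderiv 𝓘(ℝ, EG) 𝓘(ℝ, EM) R.target y : EG →L[ℝ] EM) := by
    rintro _ rfl
    exact ((R.target_submersion.contMDiff _).mdifferentiableAt (by simp)).hasMFDerivAt
  have h2 := (hRd _ (hφ.map_unit a).symm).comp (Q.unit a) hFd
  have h3 := (((hF.contMDiff_base hφ) _).mdifferentiableAt (by simp)).hasMFDerivAt.comp (Q.unit a)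
    (((Q.target_submersion.contMDiff _).mdifferentiableAt (by simp)).hasMFDerivAt)
  have e : R.target ∘ F = f ∘ Q.target := funext (hF.base_target hφ)
  rw [← e] at h3
  have h4 : @Eq EM (mfderiv 𝓘(ℝ, EG) 𝓘(ℝ, EM) R.target (R.unit (f a))
      (mfderiv 𝓘(ℝ, EB) 𝓘(ℝ, EG) F (Q.unit a) v)) 0 := by
    refine (DFunLike.congr_fun (hasMFDerivAt_unique h2 h3) v).trans ?_
    exact (congrArg (mfderiv 𝓘(ℝ, EN) 𝓘(ℝ, EM) f (Q.target (Q.unit a)))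
      (Q.mfderiv_target_leftRep a X)).trans (map_zero _)
  rw [h1]
  have h5 : ∀ x y : EG, y = 0 → x = x - y := fun x y hy => by rw [hy, sub_zero]
  exact h5 _ _ ((congrArg (mfderiv 𝓘(ℝ, EM) 𝓘(ℝ, EG) R.unit (f a)) h4).trans (map_zero _))

/-- A morphism intertwines the anchors of the left structures. -/
theorem left_anchor_comp (hF : Q.IsMorphism R F) (hφ : InducesNormalMap Q R F f φ) (a : N)
    (X : Q.NormalSpace a) :
    R.leftAlgebroid.anchor (f a) (φ a X) =
      mfderiv 𝓘(ℝ, EN) 𝓘(ℝ, EM) f a (Q.leftAlgebroid.anchor a X) := by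
  have hFd := ((hF.contMDiff (Q.unit a)).mdifferentiableAt (by simp)).hasMFDerivAt
  have hRd : ∀ y, y = F (Q.unit a) → HasMFDerivAt 𝓘(ℝ, EG) 𝓘(ℝ, EM) R.source (F (Q.unit a))
      (mfderiv 𝓘(ℝ, EG) 𝓘(ℝ, EM) R.source y : EG →L[ℝ] EM) := by
    rintro _ rfl
    exact ((R.source_submersion.contMDiff _).mdifferentiableAt (by simp)).hasMFDerivAt
  have hfd : ∀ y, y = Q.source (Q.unit a) → HasMFDerivAt 𝓘(ℝ, EN) 𝓘(ℝ, EM) f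
      (Q.source (Q.unit a)) (mfderiv 𝓘(ℝ, EN) 𝓘(ℝ, EM) f y : EN →L[ℝ] EM) := by
    rintro _ rfl
    exact (((hF.contMDiff_base hφ) _).mdifferentiableAt (by simp)).hasMFDerivAt
  have h2 := (hRd _ (hφ.map_unit a).symm).comp (Q.unit a) hFd
  have h3 := (hfd _ (Q.source_unit a).symm).comp (Q.unit a)
    (((Q.source_submersion.contMDiff _).mdifferentiableAt (by simp)).hasMFDerivAt)
  have e : R.source ∘ F = f ∘ Q.source := funext (hF.base_source hφ)
  rw [← e] at h3
  have h4 := DFunLike.congr_fun (hasMFDerivAt_unique h2 h3) (Q.leftRep a X)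
  exact (congrArg (mfderiv 𝓘(ℝ, EG) 𝓘(ℝ, EM) R.source (R.unit (f a)))
    (hF.mfderiv_leftRep hφ a X).symm).trans h4

/-- Left prolongations are related along a morphism. -/
theorem mfderiv_leftProlongation (hF : Q.IsMorphism R F) (hφ : InducesNormalMap Q R F f φ)
    {z : ∀ a, Q.NormalSpace a} {Z : ∀ b, R.NormalSpace b} (g : B)
    (hZ : Z (f (Q.source g)) = φ (Q.source g) (z (Q.source g))) :
    mfderiv 𝓘(ℝ, EB) 𝓘(ℝ, EG) F g (Q.leftProlongation z g) = R.leftProlongation Z (F g) := by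
  set h := Q.unit (Q.source g) with hh
  have hc : Q.source g = Q.target h := (Q.target_unit _).symm
  have hFh : F h = R.unit (R.source (F g)) := by rw [hh, hφ.map_unit, hF.base_source hφ]
  set v : EB := Q.leftRep (Q.source g) (z (Q.source g)) with hv
  have hFd : ∀ y x, y = x → HasMFDerivAt 𝓘(ℝ, EB) 𝓘(ℝ, EG) F x
      (mfderiv 𝓘(ℝ, EB) 𝓘(ℝ, EG) F y : EB →L[ℝ] EG) := by
    rintro _ x rfl
    exact ((hF.contMDiff _).mdifferentiableAt (by simp)).hasMFDerivAt
  have h1 := (hFd g (Q.mul g h) (Q.mul_unit g).symm).hasMFDerivWithinAt (s := univ) |>.comp h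
    (Q.hasMFDerivWithinAt_mul g h hc) (subset_univ _)
  have hR : ∀ y, y = F h → HasMFDerivWithinAt 𝓘(ℝ, EG) 𝓘(ℝ, EG) (R.mul (F g))
      {k | R.target k = R.source (F g)} (F h)
      (mfderivWithin 𝓘(ℝ, EG) 𝓘(ℝ, EG) (R.mul (F g)) {k | R.target k = R.source (F g)} y :
        EG →L[ℝ] EG) := by
    rintro _ rfl
    exact R.hasMFDerivWithinAt_mul _ _ (hF.composable g h hc)
  have h2 := (hR _ hFh.symm).comp h
    ((hFd h h rfl).hasMFDerivWithinAt (s := {k | Q.target k = Q.source g}))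
    fun k hk => (hF.composable g k (Eq.symm hk)).symm
  have h3 := h2.congr_mono (f₁ := F ∘ Q.mul g) (fun k hk => hF.map_mul g k (Eq.symm hk))
    (hF.map_mul g h hc) subset_rfl
  -- Multiplicativity gives `F ∘ l_g = l_{F g} ∘ F` on the `α`-fibre only, so the two chain-rule
  -- derivatives are compared on a vector tangent to that fibre.
  have h4 := Q.target_submersion.hasMFDerivWithinAt_fibre_unique h1 h3 hc.symm (v := v)
    (Q.mfderiv_target_leftRep _ _)
  refine Eq.trans h4 ?_
  have h5 := hF.mfderiv_leftRep hφ (Q.source g) (z (Q.source g))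
  have h6 : ∀ b, b = f (Q.source g) →
      @Eq EG (mfderiv 𝓘(ℝ, EB) 𝓘(ℝ, EG) F h v) (R.leftRep b (Z b)) := by
    rintro _ rfl
    rw [hZ]
    exact h5
  exact congrArg (mfderivWithin 𝓘(ℝ, EG) 𝓘(ℝ, EG) (R.mul (F g))
    {k | R.target k = R.source (F g)} (R.unit (R.source (F g)))) (h6 _ (hF.base_source hφ g))

end IsMorphism

end SmoothQuasiloopoid

/-! ### The bracket formula for families of sections. -/

namespace SmoothQuasiloopoid

variable {EB : Type*} [NormedAddCommGroup EB] [NormedSpace ℝ EB] [FiniteDimensional ℝ EB]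
  {B : Type*} [TopologicalSpace B] [ChartedSpace EB B] [IsManifold 𝓘(ℝ, EB) ∞ B]
  {EN : Type*} [NormedAddCommGroup EN] [NormedSpace ℝ EN] [FiniteDimensional ℝ EN]
  {N : Type*} [TopologicalSpace N] [ChartedSpace EN N] [IsManifold 𝓘(ℝ, EN) ∞ N]
  {EG : Type*} [NormedAddCommGroup EG] [NormedSpace ℝ EG] [FiniteDimensional ℝ EG]
  {G : Type*} [TopologicalSpace G] [ChartedSpace EG G] [IsManifold 𝓘(ℝ, EG) ∞ G]
  {EM : Type*} [NormedAddCommGroup EM] [NormedSpace ℝ EM] [FiniteDimensional ℝ EM]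
  {M : Type*} [TopologicalSpace M] [ChartedSpace EM M] [IsManifold 𝓘(ℝ, EM) ∞ M]

section FamilyOfSections

variable (R : SmoothQuasiloopoid EG G EM M) {Z : N → ∀ y, R.NormalSpace y}

theorem contMDiff_leftProlongation_family
    (hZ : ContMDiff (𝓘(ℝ, EN).prod 𝓘(ℝ, EM)) (𝓘(ℝ, EM).prod 𝓘(ℝ, NormalModel EG EM)) ∞
      (fun q : N × M => (⟨q.2, Z q.1 q.2⟩ : TotalSpace (NormalModel EG EM) R.NormalSpace))) :
    ContMDiff (𝓘(ℝ, EN).prod 𝓘(ℝ, EG)) 𝓘(ℝ, EG).tangent ∞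
      (fun q : N × G => (⟨q.2, R.leftProlongation (Z q.1) q.2⟩ : TangentBundle 𝓘(ℝ, EG) G)) :=
  fun q => R.contMDiffAt_leftTranslate (g := fun q : N × G => q.2)
    (X := fun q => Z q.1 (R.source q.2)) contMDiffAt_snd
    ((hZ _).comp (f := fun q : N × G => (q.1, R.source q.2)) q
      (contMDiffAt_fst.prodMk ((R.source_submersion.contMDiff _).comp q contMDiffAt_snd)))

/-- At the unit over `y` the prolongation is the fixed linear map `R.leftRep y` applied to `Z x y`.
It passes through the derivative in `x`, and projection to the normal bundle undoes it. -/
theorem normalMk_tangentDeriv_leftProlongation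
    (hZ : ContMDiff (𝓘(ℝ, EN).prod 𝓘(ℝ, EM)) (𝓘(ℝ, EM).prod 𝓘(ℝ, NormalModel EG EM)) ∞
      (fun q : N × M => (⟨q.2, Z q.1 q.2⟩ : TotalSpace (NormalModel EG EM) R.NormalSpace)))
    (x : N) (y : M) (v : TangentSpace 𝓘(ℝ, EN) x) :
    R.normalMk y (tangentDeriv (fun x => R.leftProlongation (Z x) (R.unit y)) x v) =
      fibreDeriv (NormalModel EG EM) R.NormalSpace 𝓘(ℝ, EN) y (fun x => Z x y) x v := by
  have hs : ContMDiffAt 𝓘(ℝ, EN) (𝓘(ℝ, EM).prod 𝓘(ℝ, NormalModel EG EM)) ∞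
      (fun n => (⟨y, Z n y⟩ : TotalSpace (NormalModel EG EM) R.NormalSpace)) x :=
    (hZ (x, y)).comp (f := fun n => (n, y)) x (contMDiffAt_id.prodMk contMDiffAt_const)
  have h := mvfderiv_linear_comp (E' := EG) hs (R.leftRep y) v
  have e : (fun x => R.leftProlongation (Z x) (R.unit y)) = fun n => R.leftRep y (Z n y) :=
    funext fun n => R.leftProlongation_unit (Z n) y
  rw [e]
  exact (congrArg (R.normalMk y) h).trans (R.normalMk_leftRep y _)

end FamilyOfSections

namespace IsMorphism

variable {Q : SmoothQuasiloopoid EB B EN N} {R : SmoothQuasiloopoid EG G EM M} {F : B → G}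
  {f : N → M} {φ : ∀ a, Q.NormalSpace a →ₗ[ℝ] R.NormalSpace (f a)}

/-- The image under a morphism of the left bracket of two sections, in terms of families of
sections of the target that extend the images of the two sections. -/
theorem normalMap_left_bracket (hF : Q.IsMorphism R F) (hφ : InducesNormalMap Q R F f φ)
    {z w : ∀ a, Q.NormalSpace a} (hz : IsSmoothSection 𝓘(ℝ, EN) (NormalModel EB EN) z)
    (hw : IsSmoothSection 𝓘(ℝ, EN) (NormalModel EB EN) w)
    {Z W : N → ∀ y, R.NormalSpace y}
    (hZ : ContMDiff (𝓘(ℝ, EN).prod 𝓘(ℝ, EM)) (𝓘(ℝ, EM).prod 𝓘(ℝ, NormalModel EG EM)) ∞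
      (fun q : N × M => (⟨q.2, Z q.1 q.2⟩ : TotalSpace (NormalModel EG EM) R.NormalSpace)))
    (hW : ContMDiff (𝓘(ℝ, EN).prod 𝓘(ℝ, EM)) (𝓘(ℝ, EM).prod 𝓘(ℝ, NormalModel EG EM)) ∞
      (fun q : N × M => (⟨q.2, W q.1 q.2⟩ : TotalSpace (NormalModel EG EM) R.NormalSpace)))
    (hzZ : ∀ x, Z x (f x) = φ x (z x)) (hwW : ∀ x, W x (f x) = φ x (w x)) (a : N) :
    φ a (Q.leftAlgebroid.bracket z w a) =
      R.leftAlgebroid.bracket (Z a) (W a) (f a) +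
        fibreDeriv (NormalModel EG EM) R.NormalSpace 𝓘(ℝ, EN) (f a) (fun x => W x (f a)) a
          (Q.leftAlgebroid.anchor a (z a)) -
        fibreDeriv (NormalModel EG EM) R.NormalSpace 𝓘(ℝ, EN) (f a) (fun x => Z x (f a)) a
          (Q.leftAlgebroid.anchor a (w a)) := by
  -- The parameter map is `β`: at `b` the prolongation of `z` is related to that of `Z (β b)`, since
  -- both depend on the section only over `β b`. The differential of `β` on the representatives at
  -- the unit is the left anchor.
  have h := mfderiv_mlieBracket_of_related (e := Q.unit a) hF.contMDiff
    (Q.source_submersion.contMDiff _)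
    (Q.contMDiff_leftProlongation hz _) (Q.contMDiff_leftProlongation hw _)
    (V := fun x => R.leftProlongation (Z x)) (U := fun x => R.leftProlongation (W x))
    (R.contMDiff_leftProlongation_family hZ _) (R.contMDiff_leftProlongation_family hW _)
    (fun b => hF.mfderiv_leftProlongation hφ b (hzZ _))
    (fun b => hF.mfderiv_leftProlongation hφ b (hwW _))
  rw [Q.leftProlongation_unit, Q.leftProlongation_unit] at h
  have key : ∀ x u, x = a → u = R.unit (f a) → ∀ s t : EN,
      @Eq EG (mlieBracket 𝓘(ℝ, EG) (R.leftProlongation (Z x)) (R.leftProlongation (W x)) u +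
        tangentDeriv (fun x => R.leftProlongation (W x) u) x s -
        tangentDeriv (fun x => R.leftProlongation (Z x) u) x t)
      (mlieBracket 𝓘(ℝ, EG) (R.leftProlongation (Z a)) (R.leftProlongation (W a)) (R.unit (f a)) +
        tangentDeriv (fun x => R.leftProlongation (W x) (R.unit (f a))) a s -
        tangentDeriv (fun x => R.leftProlongation (Z x) (R.unit (f a))) a t) := by
    rintro _ _ rfl rfl s t
    rfl
  have h2 := h.trans (key _ _ (Q.source_unit a) (hφ.map_unit a) _ _)
  refine (hφ.map_normalMk a _).trans ((congrArg (R.normalMk (f a)) h2).trans ?_)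
  have e : ∀ s t u : TangentSpace 𝓘(ℝ, EG) (R.unit (f a)), R.normalMk (f a) (s + t - u) =
      R.normalMk (f a) s + R.normalMk (f a) t - R.normalMk (f a) u := fun s t u => by
    rw [map_sub, map_add]
  refine (e _ _ _).trans ?_
  refine congrArg₂ (· - ·) (congrArg₂ (· + ·) rfl ?_) ?_
  · exact R.normalMk_tangentDeriv_leftProlongation hW a (f a) (Q.leftAlgebroid.anchor a (z a))
  · exact R.normalMk_tangentDeriv_leftProlongation hZ a (f a) (Q.leftAlgebroid.anchor a (w a))

end IsMorphism

end SmoothQuasiloopoid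

/-! ### Local frames of the graph of a bundle morphism. -/

section GraphFrame

variable {E₁ : Type*} [NormedAddCommGroup E₁] [NormedSpace ℝ E₁]
  {H₁ : Type*} [TopologicalSpace H₁] {I₁ : ModelWithCorners ℝ E₁ H₁}
  {M₁ : Type*} [TopologicalSpace M₁] [ChartedSpace H₁ M₁] [IsManifold I₁ ∞ M₁]
  {F₁ : Type*} [NormedAddCommGroup F₁] [NormedSpace ℝ F₁] [FiniteDimensional ℝ F₁]
  {V₁ : M₁ → Type*}
  [TopologicalSpace (TotalSpace F₁ V₁)] [∀ x, TopologicalSpace (V₁ x)] [∀ x, AddCommGroup (V₁ x)]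
  [∀ x, Module ℝ (V₁ x)] [FiberBundle F₁ V₁] [VectorBundle ℝ F₁ V₁]
  [ContMDiffVectorBundle ∞ F₁ V₁ I₁]
  {E₂ : Type*} [NormedAddCommGroup E₂] [NormedSpace ℝ E₂]
  {H₂ : Type*} [TopologicalSpace H₂] {I₂ : ModelWithCorners ℝ E₂ H₂}
  {M₂ : Type*} [TopologicalSpace M₂] [ChartedSpace H₂ M₂]
  {F₂ : Type*} [NormedAddCommGroup F₂] [NormedSpace ℝ F₂] {V₂ : M₂ → Type*}
  [TopologicalSpace (TotalSpace F₂ V₂)] [∀ x, TopologicalSpace (V₂ x)] [∀ x, AddCommGroup (V₂ x)]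
  [∀ x, Module ℝ (V₂ x)] [FiberBundle F₂ V₂] [VectorBundle ℝ F₂ V₂]

/-- The graph of a smooth vector bundle morphism has local frames. -/
theorem exists_frame_graph {f : M₁ → M₂} {φ : ∀ x, V₁ x →ₗ[ℝ] V₂ (f x)}
    (hφ : ContMDiff (I₁.prod 𝓘(ℝ, F₁)) (I₂.prod 𝓘(ℝ, F₂)) ∞
      fun e : TotalSpace F₁ V₁ => (⟨f e.1, φ e.1 e.2⟩ : TotalSpace F₂ V₂)) (n₀ : M₁) :
    ∃ U : Set M₁, IsOpen U ∧ n₀ ∈ U ∧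
    ∃ (k : ℕ) (s : Fin k → ∀ n, ExternalProduct I₁ V₁ I₂ V₂ (n, f n)),
      (∀ i, ContMDiffOn I₁ ((I₁.prod I₂).prod 𝓘(ℝ, F₁ × F₂)) ∞
        (fun n => (⟨(n, f n), s i n⟩ :
          TotalSpace (F₁ × F₂) (ExternalProduct I₁ V₁ I₂ V₂))) U) ∧
      ∀ n ∈ U, LinearIndependent ℝ (fun i => s i n) ∧
        Submodule.span ℝ (range fun i => s i n) = (φ n).graph := by
  let e := trivializationAt F₁ V₁ n₀
  let b := Module.finBasis ℝ F₁
  have hb := e.isLocalFrameOn_localFrame_baseSet I₁ ∞ b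
  refine ⟨e.baseSet, e.open_baseSet, FiberBundle.mem_baseSet_trivializationAt' n₀,
    -- The map `v ↦ (v, φ v)` is injective with range the graph, so it carries a local frame of `V₁`
    -- to one of the graph.
    Module.finrank ℝ F₁, fun i n => (e.localFrame b i n, φ n (e.localFrame b i n)), ?_, ?_⟩
  · intro i n hn
    refine contMDiffWithinAt_externalProduct.2 ⟨hb.contMDiffOn i n hn, ?_⟩
    exact (hφ _).comp_contMDiffWithinAt (f := fun n => (⟨n, e.localFrame b i n⟩ :
      TotalSpace F₁ V₁)) n (hb.contMDiffOn i n hn)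
  · intro n hn
    have hinj : LinearMap.ker (LinearMap.id.prod (φ n)) = ⊥ := by
      rw [LinearMap.ker_prod, LinearMap.ker_id, bot_inf_eq]
    refine ⟨(hb.linearIndependent hn).map' (LinearMap.id.prod (φ n)) hinj, ?_⟩
    rw [LinearMap.graph_eq_range_prod, LinearMap.range_eq_map, ← top_le_iff.1 (hb.generating hn),
      Submodule.map_span, ← range_comp]
    rfl

end GraphFrame

/-! ### The induced map is a morphism of left structures. -/

namespace SmoothQuasiloopoid

variable {EB : Type*} [NormedAddCommGroup EB] [NormedSpace ℝ EB] [FiniteDimensional ℝ EB]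
  {B : Type*} [TopologicalSpace B] [ChartedSpace EB B] [IsManifold 𝓘(ℝ, EB) ∞ B]
  {EN : Type*} [NormedAddCommGroup EN] [NormedSpace ℝ EN] [FiniteDimensional ℝ EN]
  {N : Type*} [TopologicalSpace N] [ChartedSpace EN N] [IsManifold 𝓘(ℝ, EN) ∞ N]
  {EG : Type*} [NormedAddCommGroup EG] [NormedSpace ℝ EG] [FiniteDimensional ℝ EG]
  {G : Type*} [TopologicalSpace G] [ChartedSpace EG G] [IsManifold 𝓘(ℝ, EG) ∞ G]
  {EM : Type*} [NormedAddCommGroup EM] [NormedSpace ℝ EM] [FiniteDimensional ℝ EM]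
  {M : Type*} [TopologicalSpace M] [ChartedSpace EM M] [IsManifold 𝓘(ℝ, EM) ∞ M]

namespace IsMorphism

variable {Q : SmoothQuasiloopoid EB B EN N} {R : SmoothQuasiloopoid EG G EM M} {F : B → G}
  {f : N → M} {φ : ∀ a, Q.NormalSpace a →ₗ[ℝ] R.NormalSpace (f a)}

theorem contMDiff_normalMap (hF : Q.IsMorphism R F) (hφ : InducesNormalMap Q R F f φ) :
    ContMDiff (𝓘(ℝ, EN).prod 𝓘(ℝ, NormalModel EB EN)) (𝓘(ℝ, EM).prod 𝓘(ℝ, NormalModel EG EM)) ∞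
      fun e : TotalSpace (NormalModel EB EN) Q.NormalSpace =>
        (⟨f e.1, φ e.1 e.2⟩ : TotalSpace (NormalModel EG EM) R.NormalSpace) := by
  intro e₀
  have h1 := Q.contMDiffAt_leftRep (a := fun e : TotalSpace (NormalModel EB EN) Q.NormalSpace => e.1)
    (X := fun e => e.2) (p₀ := e₀) contMDiffAt_id
  have h2 := ContMDiffAt.mfderiv_along (f := fun _ => F) 
    (m := fun e : TotalSpace (NormalModel EB EN) Q.NormalSpace => Q.unit e.1)
    ((hF.contMDiff _).comp (f := Prod.snd) (e₀, Q.unit e₀.1) contMDiffAt_snd) h1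
  have h3 : ContMDiffAt (𝓘(ℝ, EN).prod 𝓘(ℝ, NormalModel EB EN)) 𝓘(ℝ, EG).tangent ∞
      (fun e : TotalSpace (NormalModel EB EN) Q.NormalSpace =>
        (⟨R.unit (f e.1), R.leftRep (f e.1) (φ e.1 e.2)⟩ : TangentBundle 𝓘(ℝ, EG) G)) e₀ :=
    h2.congr_of_eventuallyEq (Filter.Eventually.of_forall fun e =>
      TangentBundle.mk_congr (hφ.map_unit _).symm (hF.mfderiv_leftRep hφ _ _).symm)
  refine (R.contMDiffAt_normalMk (a := fun e : TotalSpace _ Q.NormalSpace => f e.1)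
    h3).congr_of_eventuallyEq (Filter.Eventually.of_forall fun e => ?_)
  simp only [R.normalMk_leftRep]

theorem inducesNormalMap_id (Q : SmoothQuasiloopoid EB B EN N) :
    InducesNormalMap Q Q (fun x => x) (fun x => x) fun _ => LinearMap.id :=
  ⟨fun _ => rfl, fun a v => congrArg (Q.normalMk a) (DFunLike.congr_fun
    (mfderiv_id (I := 𝓘(ℝ, EB)) (x := Q.unit a)) v).symm⟩

/-- With `z` and `w` the first components of `Z` and `W` restricted to the graph, the product
bracket at `(n, f n)` is the pair of `[z, w]` and its image under `φ`. Both components come from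
`normalMap_left_bracket`, so no decomposition of `φ ∘ z` into sections of the target is needed. -/
theorem left_bracket_graph (hF : Q.IsMorphism R F) (hφ : InducesNormalMap Q R F f φ)
    {Z W : ∀ p, ExternalProduct 𝓘(ℝ, EN) Q.NormalSpace 𝓘(ℝ, EM) R.NormalSpace p}
    (hZ : IsSmoothSection (𝓘(ℝ, EN).prod 𝓘(ℝ, EM)) (NormalModel EB EN × NormalModel EG EM) Z)
    (hW : IsSmoothSection (𝓘(ℝ, EN).prod 𝓘(ℝ, EM)) (NormalModel EB EN × NormalModel EG EM) W)
    (hZg : ∀ n, Z (n, f n) ∈ (φ n).graph) (hWg : ∀ n, W (n, f n) ∈ (φ n).graph) (n : N) :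
    (Q.leftAlgebroid.prod (NormalModel EB EN) (NormalModel EG EM) R.leftAlgebroid).bracket
      Z W (n, f n) ∈ (φ n).graph := by
  have hf := hF.contMDiff_base hφ
  have split : ∀ {Y : ∀ p, ExternalProduct 𝓘(ℝ, EN) Q.NormalSpace 𝓘(ℝ, EM) R.NormalSpace p},
      IsSmoothSection (𝓘(ℝ, EN).prod 𝓘(ℝ, EM)) (NormalModel EB EN × NormalModel EG EM) Y →
      ContMDiff (𝓘(ℝ, EN).prod 𝓘(ℝ, EM)) (𝓘(ℝ, EN).prod 𝓘(ℝ, NormalModel EB EN)) ∞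
        (fun q : N × M => (⟨q.1, (Y q).1⟩ : TotalSpace (NormalModel EB EN) Q.NormalSpace)) ∧
      ContMDiff (𝓘(ℝ, EN).prod 𝓘(ℝ, EM)) (𝓘(ℝ, EM).prod 𝓘(ℝ, NormalModel EG EM)) ∞
        (fun q : N × M => (⟨q.2, (Y q).2⟩ : TotalSpace (NormalModel EG EM) R.NormalSpace)) :=
    fun hY => ⟨fun q => (contMDiffWithinAt_externalProduct.1 (hY q)).1,
      fun q => (contMDiffWithinAt_externalProduct.1 (hY q)).2⟩
  obtain ⟨hZ1, hZ2⟩ := split hZ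
  obtain ⟨hW1, hW2⟩ := split hW
  have hg : ContMDiff 𝓘(ℝ, EN) (𝓘(ℝ, EN).prod 𝓘(ℝ, EM)) ∞ fun x => (x, f x) :=
    contMDiff_id.prodMk hf
  have hg' : ContMDiff (𝓘(ℝ, EN).prod 𝓘(ℝ, EN)) (𝓘(ℝ, EN).prod 𝓘(ℝ, EM)) ∞
      fun q : N × N => (q.2, f q.1) := contMDiff_snd.prodMk (hf.comp contMDiff_fst)
  have hZs : ∀ n, (Z (n, f n)).2 = φ n (Z (n, f n)).1 := hZg
  have hWs : ∀ n, (W (n, f n)).2 = φ n (W (n, f n)).1 := hWg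
  have h2 := hF.normalMap_left_bracket hφ (z := fun x => (Z (x, f x)).1)
    (w := fun x => (W (x, f x)).1) (Z := fun x y => (Z (x, y)).2) (W := fun x y => (W (x, y)).2)
    (hZ1.comp hg) (hW1.comp hg) hZ2 hW2 hZs hWs n
  -- The identity morphism with the families `y ↦ Z₁ (y, f x)`, whose diagonal values are `z`,
  -- expands `[z, w]` into the bracket at the frozen parameter `f n` and derivatives in that
  -- parameter.
  have h1 := (IsMorphism.id Q).normalMap_left_bracket (inducesNormalMap_id Q)
    (z := fun x => (Z (x, f x)).1) (w := fun x => (W (x, f x)).1)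
    (Z := fun x y => (Z (y, f x)).1) (W := fun x y => (W (y, f x)).1)
    (hZ1.comp hg) (hW1.comp hg) (hZ1.comp hg') (hW1.comp hg') (fun _ => rfl) (fun _ => rfl) n
  -- The chain rule through `f` turns the direction `ρ(X)` in `N` into `df (ρ(X)) = ρ(φ X)` in `M`,
  -- the direction occurring in the product bracket.
  have hd : ∀ {Y : ∀ p, ExternalProduct 𝓘(ℝ, EN) Q.NormalSpace 𝓘(ℝ, EM) R.NormalSpace p},
      ContMDiff (𝓘(ℝ, EN).prod 𝓘(ℝ, EM)) (𝓘(ℝ, EN).prod 𝓘(ℝ, NormalModel EB EN)) ∞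
        (fun q : N × M => (⟨q.1, (Y q).1⟩ : TotalSpace (NormalModel EB EN) Q.NormalSpace)) →
      ∀ X : Q.NormalSpace n,
      fibreDeriv (NormalModel EB EN) Q.NormalSpace 𝓘(ℝ, EN) n (fun x => (Y (n, f x)).1) n
        (Q.leftAlgebroid.anchor n X) =
      fibreDeriv (NormalModel EB EN) Q.NormalSpace 𝓘(ℝ, EM) n (fun y => (Y (n, y)).1) (f n)
        (R.leftAlgebroid.anchor (f n) (φ n X)) := by
    intro Y hY X
    rw [hF.left_anchor_comp hφ]
    exact fibreDeriv_comp (s := fun y => (Y (n, y)).1) ((hY (n, f n)).comp (f := fun y => (n, y)) (f n)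
      (contMDiffAt_const.prodMk contMDiffAt_id)) ((hf n).mdifferentiableAt (by simp)) _
  have h3 := h1.trans (congrArg₂ (· - ·) (congrArg₂ (· + ·) rfl (hd hW1 (Z (n, f n)).1))
    (hd hZ1 (W (n, f n)).1))
  rw [← hZs, ← hWs] at h3
  exact h2.symm.trans (congrArg (φ n) h3)

/-- The map of normal bundles induced by a morphism is a morphism of the left structures. -/
theorem isSkewAlgebroidMorphism_left (hF : Q.IsMorphism R F) (hφ : InducesNormalMap Q R F f φ) :
    IsSkewAlgebroidMorphism (NormalModel EB EN) (NormalModel EG EM)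
      Q.leftAlgebroid R.leftAlgebroid f φ where
  contMDiff_base := hF.contMDiff_base hφ
  contMDiff_total := hF.contMDiff_normalMap hφ
  graph :=
    { isSmoothEmbedding := (hF.contMDiff_base hφ).isSmoothEmbedding_graph
      exists_frame := exists_frame_graph (hF.contMDiff_normalMap hφ)
      anchor_mem := by
        intro n e he
        have he' : e.2 = φ n e.1 := he
        have hfd := ((hF.contMDiff_base hφ) n).mdifferentiableAt (by simp)
        refine ⟨Q.leftAlgebroid.anchor n e.1, ?_⟩
        have h := ((hasMFDerivAt_id n).prodMk hfd.hasMFDerivAt).mfderiv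
        refine (DFunLike.congr_fun h _).trans (Prod.ext rfl ?_)
        refine (hF.left_anchor_comp hφ n e.1).symm.trans ?_
        rw [← he']
        rfl
      bracket_mem := fun Z W hZ hW hZg hWg n => hF.left_bracket_graph hφ hZ hW hZg hWg n }

end IsMorphism

end SmoothQuasiloopoid

/-! ### Right structures and functoriality. -/

namespace SmoothQuasiloopoid

variable {EB : Type*} [NormedAddCommGroup EB] [NormedSpace ℝ EB] [FiniteDimensional ℝ EB]
  {B : Type*} [TopologicalSpace B] [ChartedSpace EB B] [IsManifold 𝓘(ℝ, EB) ∞ B]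
  {EN : Type*} [NormedAddCommGroup EN] [NormedSpace ℝ EN] [FiniteDimensional ℝ EN]
  {N : Type*} [TopologicalSpace N] [ChartedSpace EN N] [IsManifold 𝓘(ℝ, EN) ∞ N]
  {EG : Type*} [NormedAddCommGroup EG] [NormedSpace ℝ EG] [FiniteDimensional ℝ EG]
  {G : Type*} [TopologicalSpace G] [ChartedSpace EG G] [IsManifold 𝓘(ℝ, EG) ∞ G]
  {EM : Type*} [NormedAddCommGroup EM] [NormedSpace ℝ EM] [FiniteDimensional ℝ EM]
  {M : Type*} [TopologicalSpace M] [ChartedSpace EM M] [IsManifold 𝓘(ℝ, EM) ∞ M]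
  {EK : Type*} [NormedAddCommGroup EK] [NormedSpace ℝ EK] [FiniteDimensional ℝ EK]
  {K : Type*} [TopologicalSpace K] [ChartedSpace EK K] [IsManifold 𝓘(ℝ, EK) ∞ K]
  {EP : Type*} [NormedAddCommGroup EP] [NormedSpace ℝ EP] [FiniteDimensional ℝ EP]
  {P : Type*} [TopologicalSpace P] [ChartedSpace EP P] [IsManifold 𝓘(ℝ, EP) ∞ P]

namespace IsMorphism

variable {Q : SmoothQuasiloopoid EB B EN N} {R : SmoothQuasiloopoid EG G EM M}
  {S : SmoothQuasiloopoid EK K EP P} {F : B → G} {F' : G → K}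

theorem op (hF : Q.IsMorphism R F) : Q.op.IsMorphism R.op F :=
  ⟨hF.contMDiff, fun x y h => (hF.composable y x h.symm).symm, fun x y h => hF.map_mul y x h.symm⟩

theorem inducesNormalMap (hF : Q.IsMorphism R F) :
    InducesNormalMap Q R F (Q.baseMap R F) hF.normalMap :=
  ⟨hF.map_unit, fun _ _ => rfl⟩

/-- The base map of `hF.op` would be defined through `R.source` rather than `R.target`. The left
statement is proved for any `f` and `φ` satisfying `InducesNormalMap`, so it applies to the opposite
with the original base map. -/
theorem isSkewAlgebroidMorphism_right (hF : Q.IsMorphism R F) :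
    IsSkewAlgebroidMorphism (NormalModel EB EN) (NormalModel EG EM)
      Q.rightAlgebroid R.rightAlgebroid (Q.baseMap R F) hF.normalMap :=
  isSkewAlgebroidMorphism_left (Q := Q.op) (R := R.op) (φ := hF.normalMap) hF.op
    ⟨hF.map_unit, fun _ _ => rfl⟩

/-- Normal spaces over propositionally equal points are different types, so functoriality is an
equality in total spaces; representatives in the model space can be compared directly. -/
theorem totalSpace_mk_normalMk_congr {a b : M} (h : a = b) {v w : EG} (hv : v = w) :
    (⟨a, R.normalMk a v⟩ : TotalSpace (NormalModel EG EM) R.NormalSpace) =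
      ⟨b, R.normalMk b w⟩ := by
  subst h hv
  rfl

theorem normalBundleMap_id : (IsMorphism.id Q).normalBundleMap = _root_.id := by
  funext ⟨a, X⟩
  obtain ⟨v, rfl⟩ := Submodule.Quotient.mk_surjective _ X
  exact totalSpace_mk_normalMk_congr (Q.target_unit a)
    (DFunLike.congr_fun (mfderiv_id (I := 𝓘(ℝ, EB)) (x := Q.unit a)) v)

theorem normalBundleMap_comp (hF' : R.IsMorphism S F') (hF : Q.IsMorphism R F) :
    (hF'.comp hF).normalBundleMap = hF'.normalBundleMap ∘ hF.normalBundleMap := by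
  funext ⟨a, X⟩
  obtain ⟨v, rfl⟩ := Submodule.Quotient.mk_surjective _ X
  refine totalSpace_mk_normalMk_congr (congrArg (fun g => S.target (F' g)) (hF.map_unit a)) ?_
  have h : mfderiv 𝓘(ℝ, EB) 𝓘(ℝ, EK) (F' ∘ F) (Q.unit a) = _ :=
    mfderiv_comp _ ((hF'.contMDiff _).mdifferentiableAt (by simp))
      ((hF.contMDiff _).mdifferentiableAt (by simp))
  refine (DFunLike.congr_fun h v).trans ?_
  have key : ∀ g, g = R.unit (Q.baseMap R F a) → ∀ w : EG,
      @Eq EK (mfderiv 𝓘(ℝ, EG) 𝓘(ℝ, EK) F' g w)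
        (mfderiv 𝓘(ℝ, EG) 𝓘(ℝ, EK) F' (R.unit (Q.baseMap R F a)) w) := by
    rintro _ rfl w
    rfl
  exact key _ (hF.map_unit a) _

end IsMorphism

end SmoothQuasiloopoid

end

theorem mainTheorem5
    {EB : Type*} [NormedAddCommGroup EB] [NormedSpace ℝ EB] [FiniteDimensional ℝ EB]
    {B : Type*} [TopologicalSpace B] [T2Space B] [ChartedSpace EB B] [IsManifold 𝓘(ℝ, EB) ∞ B]
    {EN : Type*} [NormedAddCommGroup EN] [NormedSpace ℝ EN] [FiniteDimensional ℝ EN]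
    {N : Type*} [TopologicalSpace N] [T2Space N] [ChartedSpace EN N] [IsManifold 𝓘(ℝ, EN) ∞ N]
    {EG : Type*} [NormedAddCommGroup EG] [NormedSpace ℝ EG] [FiniteDimensional ℝ EG]
    {G : Type*} [TopologicalSpace G] [T2Space G] [ChartedSpace EG G] [IsManifold 𝓘(ℝ, EG) ∞ G]
    {EM : Type*} [NormedAddCommGroup EM] [NormedSpace ℝ EM] [FiniteDimensional ℝ EM]
    {M : Type*} [TopologicalSpace M] [T2Space M] [ChartedSpace EM M] [IsManifold 𝓘(ℝ, EM) ∞ M]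
    {EK : Type*} [NormedAddCommGroup EK] [NormedSpace ℝ EK] [FiniteDimensional ℝ EK]
    {K : Type*} [TopologicalSpace K] [T2Space K] [ChartedSpace EK K] [IsManifold 𝓘(ℝ, EK) ∞ K]
    {EP : Type*} [NormedAddCommGroup EP] [NormedSpace ℝ EP] [FiniteDimensional ℝ EP]
    {P : Type*} [TopologicalSpace P] [T2Space P] [ChartedSpace EP P] [IsManifold 𝓘(ℝ, EP) ∞ P]
    (Q : SmoothQuasiloopoid EB B EN N) (R : SmoothQuasiloopoid EG G EM M)
    (S : SmoothQuasiloopoid EK K EP P)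
    (F : B → G) (hF : Q.IsMorphism R F) (F' : G → K) (hF' : R.IsMorphism S F') :
    (IsSkewAlgebroid (NormalModel EB EN) Q.leftAlgebroid ∧
      IsSkewAlgebroid (NormalModel EB EN) Q.rightAlgebroid ∧
      ∀ a X, Q.rightAlgebroid.anchor a X = -Q.leftAlgebroid.anchor a X) ∧
    (IsSkewAlgebroid (NormalModel EG EM) R.leftAlgebroid ∧
      IsSkewAlgebroid (NormalModel EG EM) R.rightAlgebroid ∧
      ∀ a X, R.rightAlgebroid.anchor a X = -R.leftAlgebroid.anchor a X) ∧
    (IsSkewAlgebroidMorphism (NormalModel EB EN) (NormalModel EG EM)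
        Q.leftAlgebroid R.leftAlgebroid (Q.baseMap R F) hF.normalMap ∧
      IsSkewAlgebroidMorphism (NormalModel EB EN) (NormalModel EG EM)
        Q.rightAlgebroid R.rightAlgebroid (Q.baseMap R F) hF.normalMap) ∧
    ((SmoothQuasiloopoid.IsMorphism.id Q).normalBundleMap = id ∧
      (hF'.comp hF).normalBundleMap = hF'.normalBundleMap ∘ hF.normalBundleMap) := by
  exact ⟨⟨Q.isSkewAlgebroid_left, Q.isSkewAlgebroid_right, Q.rightAlgebroid_anchor⟩,
    ⟨R.isSkewAlgebroid_left, R.isSkewAlgebroid_right, R.rightAlgebroid_anchor⟩,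
    ⟨hF.isSkewAlgebroidMorphism_left hF.inducesNormalMap, hF.isSkewAlgebroidMorphism_right⟩,
    SmoothQuasiloopoid.IsMorphism.normalBundleMap_id, hF'.normalBundleMap_comp hF⟩
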